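/- Let $m\ge 1$ be an integer, let $X$ be a complex Fréchet space (a Hausdorff, complete, metrizable, locally convex topological vector space over $\mathbb{C}$), let $T:X\to X$ be a continuous linear operator, and let $U\subseteq\mathbb{C}^m$ be a non-empty connected open set. A map $f:U\to X$ is called holomorphic if it is continuous and $g\circ f:U\to\mathbb{C}$ is holomorphic for every continuous linear functional $g:X\to\mathbb{C}$. Suppose that there are a holomorphic map $f:U\to X$ and a non-constant holomorphic function $\varphi:U\to\mathbb{C}$ such that $Tf(z)=\varphi(z)f(z)$ for every $z\in U$ and such that the linear span of $\{f(z):z\in U\}$ is dense in $X$. Put $a=\inf_{z\in U}|\varphi(z)|\in[0,\infty)$ and $b=\sup_{z\in U}|\varphi(z)|\in(0,\infty]$, with the conventions $0^{-1}=\infty$ and $\infty^{-1}=0$. Then the set of all $x\in X$ such that for every $w\in\mathbb{C}$ with $b^{-1}<|w|<a^{-1}$ the orbit $\{(wT)^n x:n=0,1,2,\dots\}$ is dense in $X$ (that is, the set of common hypercyclic vectors of the family $\{wT: b^{-1}<|w|<a^{-1}\}$) is a dense $G_\delta$-subset of $X$. -/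

import Mathlib

open scoped ENNReal

/-- `x` is universal for the family `F` of maps if its orbit `{F a x}` is dense. -/
def universalElements {A X Y : Type*} [TopologicalSpace Y] (F : A → X → Y) : Set X :=
  {x | Dense (Set.range fun a => F a x)}

/-- The hypercyclic vectors of a continuous linear operator `T`: the universal elements of the
family of its powers `T ^ n`, `n = 0, 1, 2, …`. -/
def hypercyclicVectors {X : Type*} [AddCommGroup X] [Module ℂ X] [TopologicalSpace X]
    (T : X →L[ℂ] X) : Set X :=
  universalElements fun (n : ℕ) (x : X) => (T ^ n) x

/-- The common hypercyclic vectors of a family of continuous linear operators. -/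
def commonHypercyclicVectors {A X : Type*} [AddCommGroup X] [Module ℂ X] [TopologicalSpace X]
    (T : A → X →L[ℂ] X) : Set X :=
  ⋂ a, hypercyclicVectors (T a)

/-- A map `f` into a complex locally convex space `X` is holomorphic on `U ⊆ ℂ^m` if it is
continuous on `U` and `g ∘ f` is holomorphic on `U` for every continuous linear functional `g`. -/
def IsHolomorphicOn {m : ℕ} {X : Type*} [AddCommGroup X] [Module ℂ X] [TopologicalSpace X]
    (f : (Fin m → ℂ) → X) (U : Set (Fin m → ℂ)) : Prop :=
  ContinuousOn f U ∧ ∀ g : X →L[ℂ] ℂ, DifferentiableOn ℂ (fun z => g (f z)) U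

/-! By Baire's theorem it is enough that, for each `r` with `1/r` strictly between `a` and `b` and
each non-empty open `O`, there is a dense set of vectors whose orbits under all `wT`, with `|w|` in
a closed interval around `r`, meet `O`. Such sets are open by compactness, and countably many of
them suffice.

Put `σ = -log r`. A functional `g` vanishing at `f z` for all regular points `z` of the level `|φ| =
e^σ` satisfies `g ∘ f = 0` (`eqOn_zero_of_regular_level_set`), so these eigenvectors span a dense
subspace. Near each of them `f` can be reparametrized along a line as a field `F ξ` with eigenvalue
`e^ξ`. Averaging `e^(-inx) F(s + ix)` against a bump gives `v` such that `e^(-ns) T^n v` is near the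
target, while `e^(-ks) T^k v` is `O((k-n)^(-2))`, uniformly in `n` and in `s` near `σ`
(`IsEigenfield.isBumpApproximable`). Sums and limits extend this to every target.

One vector must serve uncountably many `w` (`exists_simultaneous_approx`). Vectors `v_j` aimed at
the times `n = jN` are summed, with slowly falling levels `l(n) = A - κ log n`. The levels sweep the
whole range of `log|w|`, yet `n l(n)` stays close to `n log|w|` over a whole block of `B` times, and
`exists_phases` rotates the targets in the block so that one of them fits `arg w`. Since `n l(n)` is
concave, it lies below its tangents; this keeps the interference between different times summable,
and a large `N` makes it small. Eigenvectors with `|φ| < e^τ`, `τ < σ`, supply starting vectors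
whose iterates are negligible. -/

set_option linter.unusedSectionVars false

open Filter Topology Metric Set

/-! ### Identity theorems on level sets of the modulus. -/

section SeveralVariables

variable {E : Type*} [NormedAddCommGroup E] [NormedSpace ℂ E]

/-- The complex line through `z` and `y` meets the ball in a convex set, so the one-variable
identity theorem applies on it. -/
theorem DifferentiableOn.eqOn_zero_of_ball {h : E → ℂ} {c z : E} {ρ : ℝ}
    (hh : DifferentiableOn ℂ h (ball c ρ)) (hz : z ∈ ball c ρ) (h0 : h =ᶠ[𝓝 z] 0) :
    EqOn h 0 (ball c ρ) := by
  intro y hy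
  let l : ℂ → E := fun s => z + s • (y - z)
  have hl : Differentiable ℂ l := by fun_prop
  have hD : IsOpen (l ⁻¹' ball c ρ) := isOpen_ball.preimage hl.continuous
  have hconv : Convex ℝ (l ⁻¹' ball c ρ) := by
    let : NormedSpace ℝ E := NormedSpace.restrictScalars ℝ ℂ E
    have hb : Convex ℝ (ball c ρ) := convex_ball c ρ
    intro s hs t ht a b ha hb' hab
    have e : l (a • s + b • t) = a • l s + b • l t := by
      have e1 : ∀ (r : ℝ) (x : E), r • x = (r : ℂ) • x := fun r x => rfl
      have hz' : (a : ℂ) • z + (b : ℂ) • z = z := by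
        rw [← add_smul, ← Complex.ofReal_add, hab]; simp
      simp only [l, e1, Complex.real_smul, add_smul, mul_smul, smul_add]
      nth_rewrite 1 [← hz']
      abel
    rw [mem_preimage, e]
    exact hb hs ht ha hb' hab
  have han : AnalyticOnNhd ℂ (h ∘ l) (l ⁻¹' ball c ρ) :=
    (hh.comp hl.differentiableOn (fun s hs => hs)).analyticOnNhd hD
  have h0l : (0 : ℂ) ∈ l ⁻¹' ball c ρ := by simpa [l] using hz
  have h1l : (1 : ℂ) ∈ l ⁻¹' ball c ρ := by simpa [l] using hy
  have hev : (h ∘ l) =ᶠ[𝓝 0] 0 := by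
    have ht : Tendsto l (𝓝 0) (𝓝 z) := by
      have := hl.continuous.tendsto 0
      simpa [l] using this
    exact ht.eventually h0
  have := han.eqOn_zero_of_preconnected_of_eventuallyEq_zero hconv.isPreconnected h0l hev h1l
  simpa [l] using this

theorem DifferentiableOn.eqOn_zero_of_eventuallyEq_zero {h : E → ℂ} {U : Set E}
    (hh : DifferentiableOn ℂ h U) (hUo : IsOpen U) (hUc : IsPreconnected U) {z : E} (hz : z ∈ U)
    (h0 : h =ᶠ[𝓝 z] 0) : EqOn h 0 U := by
  have key : U ⊆ {y | h =ᶠ[𝓝 y] 0} := by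
    refine hUc.subset_of_closure_inter_subset ?_ ⟨z, hz, h0⟩ ?_
    · exact isOpen_setOfPred_eventually_nhds
    · rintro y ⟨hy, hyU⟩
      obtain ⟨ρ, hρ, hb⟩ := Metric.isOpen_iff.1 hUo y hyU
      obtain ⟨x, hx, hxy⟩ := Metric.mem_closure_iff.1 hy ρ hρ
      have := (hh.mono hb).eqOn_zero_of_ball (z := x) (by rwa [mem_ball, dist_comm]) hx
      exact this.eventuallyEq_of_mem (ball_mem_nhds y hρ)
  exact fun y hy => (key hy).self_of_nhds

theorem DifferentiableOn.exists_ne_of_mem_nhds {φ : E → ℂ} {U : Set E}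
    (hφ : DifferentiableOn ℂ φ U) (hUo : IsOpen U) (hUc : IsPreconnected U) {z y : E} (hz : z ∈ U)
    (hy : y ∈ U) (hne : φ y ≠ φ z) {s : Set E} (hs : s ∈ 𝓝 z) : ∃ x ∈ s, φ x ≠ φ z := by
  by_contra! hcon
  have := (hφ.sub_const (φ z)).eqOn_zero_of_eventuallyEq_zero hUo hUc hz
    (by filter_upwards [hs] with x hx; simp [hcon x hx])
  exact hne (sub_eq_zero.1 (this hy))

theorem DifferentiableOn.nhds_le_map_of_ne {H : ℂ → ℂ} {D : Set ℂ} (hH : DifferentiableOn ℂ H D)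
    (hDo : IsOpen D) (hDc : IsPreconnected D) {s t : ℂ} (hs : s ∈ D) (ht : t ∈ D)
    (hne : H t ≠ H s) : 𝓝 (H s) ≤ map H (𝓝 s) := by
  rcases (hH.analyticAt (hDo.mem_nhds hs)).eventually_constant_or_nhds_le_map_nhds with h | h
  · obtain ⟨x, hx, hx'⟩ := hH.exists_ne_of_mem_nhds hDo hDc hs ht hne h
    exact absurd hx hx'
  · exact h

/-- A holomorphic function that vanishes at the regular points of a level curve of the modulus of
a non-constant holomorphic function vanishes identically. -/
theorem eqOn_zero_of_regular_level {H K : ℂ → ℂ} {D : Set ℂ} (hH : DifferentiableOn ℂ H D)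
    (hK : DifferentiableOn ℂ K D) (hDo : IsOpen D) (hDc : IsPreconnected D) {r : ℝ} (hr : 0 < r)
    {s t : ℂ} (hs : s ∈ D) (ht : t ∈ D) (hne : H t ≠ H s) (hsr : ‖H s‖ = r)
    (h0 : ∀ x ∈ D, ‖H x‖ = r → deriv H x ≠ 0 → K x = 0) : EqOn K 0 D := by
  have hopen := hH.nhds_le_map_of_ne hDo hDc hs ht hne
  have hHa := hH.analyticOnNhd hDo
  have hder : ∀ᶠ x in 𝓝[≠] s, deriv H x ≠ 0 := by
    rcases (hHa.deriv s hs).eventually_eq_zero_or_eventually_ne_zero with h | h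
    · exfalso
      obtain ⟨ρ, hρ, hb⟩ := Metric.eventually_nhds_iff_ball.1 (h.and (hDo.mem_nhds hs))
      obtain ⟨x, hx, hx'⟩ :=
        hH.exists_ne_of_mem_nhds hDo hDc hs ht hne (ball_mem_nhds s hρ)
      refine hx' ?_
      refine (convex_ball s ρ).is_const_of_fderivWithin_eq_zero (𝕜 := ℂ) (f := H)
        (hH.mono fun y hy => (hb y hy).2) ?_ hx (mem_ball_self hρ)
      intro y hy
      rw [fderivWithin_of_isOpen isOpen_ball hy]
      ext
      simpa using (hb y hy).1
    · exact h
  refine (hK.analyticOnNhd hDo).eqOn_zero_of_preconnected_of_frequently_eq_zero hDc hs ?_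
  intro hK0
  have hD : ∀ᶠ x in 𝓝[≠] s, x ∈ D := nhdsWithin_le_nhds (hDo.mem_nhds hs)
  -- If the zeros of `K` do not accumulate at `s`, then `s` is isolated in the level set, because
  -- critical points do not accumulate there either.
  have hV : ∀ᶠ x in 𝓝 s, x ≠ s → ‖H x‖ ≠ r := by
    have : ∀ᶠ x in 𝓝[≠] s, ‖H x‖ ≠ r := by
      filter_upwards [hK0, hder, hD] with x h1 h2 h3 h4
      exact h1 (h0 x h3 h4 h2)
    rw [eventually_nhdsWithin_iff] at this
    exact this
  have himg : H '' {x | x ≠ s → ‖H x‖ ≠ r} ∈ 𝓝 (H s) := hopen (image_mem_map hV)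
  -- Since `H` is open at `s`, a slight rotation of `H s` has a preimage near `s`, still on the
  -- level. Taking `θ` in `(0, 1)` gives `sin θ > 0`, which rules out the preimage `s` itself.
  have hrot : Tendsto (fun θ : ℝ => Complex.exp (θ * Complex.I) * H s) (𝓝[>] 0) (𝓝 (H s)) := by
    have : Continuous (fun θ : ℝ => Complex.exp (θ * Complex.I) * H s) := by fun_prop
    have h := this.tendsto 0
    simp only [Complex.ofReal_zero, zero_mul, Complex.exp_zero, one_mul] at h
    exact h.mono_left nhdsWithin_le_nhds
  have hlt : ∀ᶠ θ : ℝ in 𝓝[>] 0, θ ∈ Ioo (0 : ℝ) 1 := Ioo_mem_nhdsGT one_pos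
  obtain ⟨θ, ⟨x, hx, hxθ⟩, hθ⟩ := ((hrot.eventually himg).and hlt).exists
  have hxr : ‖H x‖ = r := by rw [hxθ, norm_mul, Complex.norm_exp_ofReal_mul_I, one_mul, hsr]
  by_cases hxs : x = s
  · subst hxs
    have hHx : H x ≠ 0 := by
      rw [← norm_pos_iff, hsr]; exact hr
    have h1 : Complex.exp (θ * Complex.I) = 1 := by
      field_simp at hxθ
      exact hxθ.symm
    have him : Real.sin θ = 0 := by
      have := congrArg Complex.im h1
      simpa [Complex.exp_ofReal_mul_I_im] using this
    have : 0 < Real.sin θ :=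
      Real.sin_pos_of_pos_of_lt_pi hθ.1 (by linarith [hθ.2, Real.pi_gt_three])
    linarith
  · exact hx hxs hxr

theorem exists_norm_lt_and_lt_of_nhds_le_map {H : ℂ → ℂ} {s : ℂ} (h : 𝓝 (H s) ≤ map H (𝓝 s))
    (h0 : H s ≠ 0) {D : Set ℂ} (hD : D ∈ 𝓝 s) :
    (∃ x ∈ D, ‖H x‖ < ‖H s‖) ∧ ∃ x ∈ D, ‖H s‖ < ‖H x‖ := by
  have himg : H '' D ∈ 𝓝 (H s) := h (image_mem_map hD)
  have hpos : 0 < ‖H s‖ := norm_pos_iff.2 h0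
  have hc : Continuous (fun t : ℝ => ((1 + t : ℝ) : ℂ) * H s) := by fun_prop
  have ht : Tendsto (fun t : ℝ => ((1 + t : ℝ) : ℂ) * H s) (𝓝 0) (𝓝 (H s)) := by
    simpa using hc.tendsto 0
  constructor
  · have hlt : ∀ᶠ t : ℝ in 𝓝[<] 0, t ∈ Ioo (-1 : ℝ) 0 := Ioo_mem_nhdsLT (by norm_num)
    obtain ⟨t, ⟨x, hx, hxt⟩, h1⟩ :=
      (((ht.mono_left nhdsWithin_le_nhds).eventually himg).and hlt).exists
    refine ⟨x, hx, ?_⟩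
    rw [hxt, norm_mul, Complex.norm_real, Real.norm_of_nonneg (by linarith [h1.1])]
    nlinarith [h1.2]
  · have hlt : ∀ᶠ t : ℝ in 𝓝[>] 0, t ∈ Ioo (0 : ℝ) 1 := Ioo_mem_nhdsGT one_pos
    obtain ⟨t, ⟨x, hx, hxt⟩, h1⟩ :=
      (((ht.mono_left nhdsWithin_le_nhds).eventually himg).and hlt).exists
    refine ⟨x, hx, ?_⟩
    rw [hxt, norm_mul, Complex.norm_real, Real.norm_of_nonneg (by linarith [h1.1])]
    nlinarith [h1.1]

/-- A holomorphic function on a connected open set that vanishes at the regular points of a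
level set of the modulus of a holomorphic function vanishes identically. -/
theorem eqOn_zero_of_regular_level_set {φ G : E → ℂ} {U : Set E} (hUo : IsOpen U)
    (hUc : IsPreconnected U) (hφ : DifferentiableOn ℂ φ U) (hG : DifferentiableOn ℂ G U) {r : ℝ}
    (hr : 0 < r) (hlow : ∃ z ∈ U, ‖φ z‖ < r) (hhigh : ∃ z ∈ U, r < ‖φ z‖)
    (h0 : ∀ z ∈ U, ∀ v : E, ‖φ z‖ = r → deriv (fun s : ℂ => φ (z + s • v)) 0 ≠ 0 → G z = 0) :
    EqOn G 0 U := by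
  obtain ⟨y₁, hy₁, hlt⟩ := hlow
  obtain ⟨y₂, hy₂, hgt⟩ := hhigh
  obtain ⟨c, hc, hcr⟩ : ∃ c ∈ U, ‖φ c‖ = r :=
    hUc.intermediate_value hy₁ hy₂ hφ.continuousOn.norm ⟨hlt.le, hgt.le⟩
  -- Room for a base point within `ρ` of `c` plus a displacement `s • v` of norm below `2ρ`.
  obtain ⟨ρ, hρ, hb⟩ : ∃ ρ > 0, ball c (3 * ρ) ⊆ U := by
    obtain ⟨ρ, hρ, hb⟩ := Metric.isOpen_iff.1 hUo c hc
    exact ⟨ρ / 3, by positivity, by convert hb using 2; ring⟩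
  obtain ⟨z₁, hz₁, hne⟩ := hφ.exists_ne_of_mem_nhds hUo hUc hc hy₁
    (fun h => by rw [h, hcr] at hlt; exact lt_irrefl _ hlt) (ball_mem_nhds c hρ)
  set v := z₁ - c with hv
  have hvn : ‖v‖ < ρ := by rwa [mem_ball, dist_eq_norm] at hz₁
  set D : Set ℂ := ball 0 2 with hD
  have hmem : ∀ z ∈ ball c ρ, ∀ s ∈ D, z + s • v ∈ U := by
    intro z hz s hs
    apply hb
    rw [mem_ball, dist_eq_norm] at hz ⊢
    rw [hD, mem_ball, dist_zero_right] at hs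
    calc ‖z + s • v - c‖ = ‖(z - c) + s • v‖ := by congr 1; abel
      _ ≤ ‖z - c‖ + ‖s‖ * ‖v‖ := (norm_add_le _ _).trans (by rw [norm_smul])
      _ < 3 * ρ := by nlinarith [norm_nonneg s, norm_nonneg v]
  have hline : ∀ z ∈ ball c ρ, ∀ g : E → ℂ, DifferentiableOn ℂ g U →
      DifferentiableOn ℂ (fun s : ℂ => g (z + s • v)) D := fun z hz g hg =>
    hg.comp (f := fun s : ℂ => z + s • v) (by fun_prop) (fun s hs => hmem z hz s hs)
  have hDc : IsPreconnected D := (convex_ball 0 2).isPreconnected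
  have h0D : (0 : ℂ) ∈ D := mem_ball_self two_pos
  have h1D : (1 : ℂ) ∈ D := by simp [hD]
  have hcb : c ∈ ball c ρ := mem_ball_self hρ
  -- On the line through `c` in direction `v` the modulus of `φ` takes values below and above `r`.
  -- The same parameters work on the parallel line through any nearby `z`, so that line meets the
  -- level and the one-variable result gives `G z = 0`.
  have hopen := (hline c hcb φ hφ).nhds_le_map_of_ne isOpen_ball hDc h0D h1D (by simpa [hv] using hne)
  obtain ⟨⟨s₂, hs₂, hs₂'⟩, s₃, hs₃, hs₃'⟩ := exists_norm_lt_and_lt_of_nhds_le_map hopen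
    (by simp only [zero_smul, add_zero]; rw [← norm_pos_iff, hcr]; exact hr)
    (isOpen_ball.mem_nhds h0D)
  simp only [zero_smul, add_zero, hcr] at hs₂' hs₃'
  have hcont : ∀ s ∈ D, ContinuousAt (fun z => ‖φ (z + s • v)‖) c := by
    intro s hs
    have h1 : ContinuousAt φ (c + s • v) :=
      (hφ.differentiableAt (hUo.mem_nhds (hmem c hcb s hs))).continuousAt
    exact (ContinuousAt.comp (f := fun z => z + s • v) h1 (by fun_prop)).norm
  refine hG.eqOn_zero_of_eventuallyEq_zero hUo hUc hc ?_
  filter_upwards [ball_mem_nhds c hρ, (hcont s₂ hs₂).eventually_lt_const hs₂',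
    (hcont s₃ hs₃).eventually_const_lt hs₃'] with z hz hz2 hz3
  obtain ⟨s, hs, hsr⟩ : ∃ s ∈ D, ‖φ (z + s • v)‖ = r :=
    hDc.intermediate_value hs₂ hs₃ (hline z hz φ hφ).continuousOn.norm ⟨hz2.le, hz3.le⟩
  have := eqOn_zero_of_regular_level (hline z hz φ hφ) (hline z hz G hG) isOpen_ball hDc hr hs hs₂
    (fun h => by rw [h, hsr] at hz2; exact lt_irrefl _ hz2) hsr (fun x hx hxr hxd => by
      refine h0 _ (hmem z hz x hx) v hxr ?_
      have e : (fun s : ℂ => φ (z + x • v + s • v)) =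
          (fun s : ℂ => (fun s : ℂ => φ (z + s • v)) (x + s)) := by
        ext s; simp only [add_smul, add_assoc]
      rw [e, deriv_comp_const_add (f := fun s : ℂ => φ (z + s • v)), add_zero]
      exact hxd) h0D
  simpa using this

end SeveralVariables

/-! ### Hahn–Banach and weak integrals. -/

section LocallyConvex

variable {X : Type*} [AddCommGroup X] [Module ℂ X] [UniformSpace X] [IsUniformAddGroup X]
  [ContinuousSMul ℂ X]

theorem Seminorm.exists_forall_lt_imp_mem [PolynormableSpace ℂ X] {y : X} {O : Set X}
    (hO : O ∈ 𝓝 y) :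
    ∃ p : Seminorm ℂ X, Continuous p ∧ ∃ r > 0, ∀ x, p (x - y) < r → x ∈ O := by
  obtain ⟨s, r, hr, hs⟩ := ((PolynormableSpace.withSeminorms ℂ X).mem_nhds_iff y O).1 hO
  refine ⟨s.sup fun p : {p : Seminorm ℂ X // Continuous p} => p.1, ?_, r, hr, fun x hx => hs ?_⟩
  · exact Seminorm.continuous' (r := 1) (by
      have := ((PolynormableSpace.withSeminorms ℂ X).mem_nhds_iff 0
        ((s.sup fun p : {p : Seminorm ℂ X // Continuous p} => p.1).closedBall 0 1)).2
        ⟨s, 1, one_pos, Seminorm.ball_subset_closedBall _ _ _⟩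
      exact this)
  · rwa [Seminorm.mem_ball]

/-- Hahn–Banach extends `a • x ↦ a p(x)` under `p`. Bounds on scalar integrals thereby become
seminorm bounds, with no vector-valued integral. -/
theorem Seminorm.le_of_forall_dual_le [PolynormableSpace ℂ X] {p : Seminorm ℂ X}
    (hp : Continuous p) {x : X} {c : ℝ}
    (h : ∀ g : X →L[ℂ] ℂ, (∀ y, ‖g y‖ ≤ p y) → ‖g x‖ ≤ c) : p x ≤ c := by
  by_cases hx : x = 0
  · have := h 0 (by simp)
    simpa [hx] using this
  · obtain ⟨g, hg, hgp⟩ := Module.Dual.exists_continuous_extension_of_le_seminorm (ℂ ∙ x)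
      ((p x : ℂ) • (LinearEquiv.coord ℂ X x hx : Module.Dual ℂ (ℂ ∙ x))) hp (by
        rintro ⟨y, hy⟩
        obtain ⟨a, rfl⟩ := Submodule.mem_span_singleton.1 hy
        have : LinearEquiv.coord ℂ X x hx ⟨a • x, hy⟩ = a :=
          LinearEquiv.coord_apply_smul ℂ X x hx ⟨a • x, hy⟩ |> fun e =>
            smul_left_injective ℂ hx e
        simp only [LinearMap.smul_apply, LinearEquiv.coe_coe, this, map_smul_eq_mul]
        simp [abs_of_nonneg (apply_nonneg p x), mul_comm])
    have h1 := hg ⟨x, Submodule.mem_span_singleton_self x⟩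
    simp only [LinearMap.smul_apply, LinearEquiv.coe_coe, LinearEquiv.coord_self, smul_eq_mul,
      mul_one] at h1
    have := h g hgp
    rwa [h1, Complex.norm_real, Real.norm_of_nonneg (apply_nonneg p x)] at this

theorem Submodule.dense_of_forall_dual_eq_zero [Module ℝ X]
    [IsScalarTower ℝ ℂ X] [LocallyConvexSpace ℝ X] {S S' : Submodule ℂ X}
    (hS' : Dense (S' : Set X))
    (h : ∀ g : X →L[ℂ] ℂ, (∀ x ∈ S, g x = 0) → ∀ x ∈ S', g x = 0) : Dense (S : Set X) := by
  have : ContinuousSMul ℝ X := IsScalarTower.continuousSMul ℂ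
  intro x
  by_contra hx
  have hconv : Convex ℝ (closure (S : Set X)) := by
    refine Convex.closure ?_
    intro a ha b hb s t _ _ _
    rw [← algebraMap_smul ℂ s a, ← algebraMap_smul ℂ t b]
    exact S.add_mem (S.smul_mem _ ha) (S.smul_mem _ hb)
  obtain ⟨g, u, hg, hgx⟩ :=
    RCLike.geometric_hahn_banach_closed_point (𝕜 := ℂ) hconv isClosed_closure hx
  have hu : 0 < u := by simpa using hg 0 (subset_closure S.zero_mem)
  have h0 : ∀ y ∈ S, g y = 0 := by
    intro y hy
    by_contra hne
    -- A nonzero value of `g` on the subspace rescales to exactly `u`, against the strict bound.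
    have := hg (((u : ℂ) / g y) • y) (subset_closure (S.smul_mem _ hy))
    rw [map_smul, smul_eq_mul, div_mul_cancel₀ _ hne] at this
    simp at this
  have h1 : EqOn g 0 (S' : Set X) := fun y hy => h g h0 y hy
  have h2 : (g : X → ℂ) = 0 := Continuous.ext_on hS' g.continuous continuous_zero h1
  rw [h2] at hgx
  simp at hgx
  linarith

/-- Weak integrals of continuous curves are approximated, uniformly over the functionals
dominated by a continuous seminorm, by vectors of the space. -/
theorem exists_forall_norm_sub_integral_le {J : ℝ → X} {β : ℝ} (hβ : 0 < β)
    (hJ : ContinuousOn J (Icc 0 β)) {p : Seminorm ℂ X} (hp : Continuous p) {δ : ℝ} (hδ : 0 < δ) :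
    ∃ v : X, ∀ g : X →L[ℂ] ℂ, (∀ x, ‖g x‖ ≤ p x) →
      ‖g v - ∫ x in (0 : ℝ)..β, g (J x)‖ ≤ δ := by
  have huc := isCompact_Icc.uniformContinuousOn_of_continuous hJ
  have hV : {q : X × X | p (q.2 - q.1) < δ / β} ∈ uniformity X := by
    rw [uniformity_eq_comap_nhds_zero]
    refine ⟨{x | p x < δ / β}, ?_, fun q hq => hq⟩
    exact (isOpen_lt hp continuous_const).mem_nhds (by simpa using div_pos hδ hβ)
  obtain ⟨η, hη, hηJ⟩ :=
    (Metric.uniformity_basis_dist_le.inf_principal (Icc 0 β ×ˢ Icc 0 β)).tendsto_left_iff.1 huc _ hV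
  obtain ⟨n, hn⟩ := exists_nat_gt (β / η)
  have hn0 : (0 : ℝ) < n := (div_pos hβ hη).trans hn
  set h : ℝ := β / n with hh
  have hhpos : 0 < h := div_pos hβ hn0
  have hhη : h ≤ η := by
    rw [hh, div_le_iff₀ hn0, mul_comm]; exact ((div_lt_iff₀ hη).1 hn).le
  have hnh : n * h = β := by rw [hh]; field_simp
  have hmem : ∀ i < n, Icc (i * h) ((i + 1 : ℕ) * h) ⊆ Icc 0 β := by
    intro i hi
    refine Icc_subset_Icc (by positivity) ?_
    rw [← hnh]
    exact mul_le_mul_of_nonneg_right (by exact_mod_cast hi) hhpos.le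
  -- A left-endpoint Riemann sum: each cell contributes an error of at most `δ / β` times its
  -- length.
  refine ⟨∑ i ∈ Finset.range n, (h : ℂ) • J (i * h), fun g hg => ?_⟩
  have hgJ : ContinuousOn (fun x => g (J x)) (Icc 0 β) := g.continuous.comp_continuousOn hJ
  have hle : ∀ i : ℕ, (i : ℝ) * h ≤ (i + 1 : ℕ) * h := fun i =>
    mul_le_mul_of_nonneg_right (by simp) hhpos.le
  have hint : ∀ i < n, IntervalIntegrable (fun x => g (J x)) MeasureTheory.volume
      (i * h) ((i + 1 : ℕ) * h) := by
    intro i hi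
    refine ContinuousOn.intervalIntegrable ?_
    rw [uIcc_of_le (hle i)]
    exact hgJ.mono (hmem i hi)
  have hsum := intervalIntegral.sum_integral_adjacent_intervals (a := fun i : ℕ => (i : ℝ) * h) hint
  simp only [Nat.cast_zero, zero_mul, hnh] at hsum
  rw [← hsum, map_sum, ← Finset.sum_sub_distrib]
  have hterm : ∀ i ∈ Finset.range n, ‖g ((h : ℂ) • J (i * h)) -
      ∫ x in (i * h : ℝ)..((i + 1 : ℕ) * h), g (J x)‖ ≤ δ / β * h := by
    intro i hi
    have hi := Finset.mem_range.1 hi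
    have e : g ((h : ℂ) • J (i * h)) = ∫ _ in (i * h : ℝ)..((i + 1 : ℕ) * h), g (J (i * h)) := by
      rw [intervalIntegral.integral_const, map_smul]
      push_cast
      rw [← sub_mul, add_sub_cancel_left, one_mul, Complex.real_smul, smul_eq_mul]
    rw [e, ← intervalIntegral.integral_sub (by simp) (hint i hi)]
    refine (intervalIntegral.norm_integral_le_of_norm_le_const (C := δ / β) ?_).trans_eq ?_
    · intro x hx
      rw [uIoc_of_le (hle i)] at hx
      have hx1 : x ∈ Icc 0 β := hmem i hi ⟨hx.1.le, hx.2⟩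
      have hx2 : (i * h : ℝ) ∈ Icc 0 β := hmem i hi ⟨le_rfl, hle i⟩
      have hd : dist x (i * h) ≤ η := by
        rw [Real.dist_eq, abs_of_pos (sub_pos.2 hx.1)]
        have := hx.2
        push_cast at this
        linarith
      have : p (J (i * h) - J x) < δ / β := @hηJ (x, i * h) ⟨hd, hx1, hx2⟩
      rw [← map_sub]
      exact (hg _).trans (le_of_lt this)
    · push_cast
      rw [← sub_mul, add_sub_cancel_left, one_mul, abs_of_pos hhpos]
  refine (norm_sum_le _ _).trans ((Finset.sum_le_sum hterm).trans_eq ?_)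
  rw [Finset.sum_const, Finset.card_range, nsmul_eq_mul]
  calc (n : ℝ) * (δ / β * h) = δ / β * (n * h) := by ring
    _ = δ := by rw [hnh]; field_simp

end LocallyConvex

/-- A local weakly holomorphic field `F` of eigenvectors of `T` with eigenvalues `exp ξ`. -/
structure IsEigenfield {X : Type*} [AddCommGroup X] [Module ℂ X] [TopologicalSpace X]
    (T : X →L[ℂ] X) (F : ℂ → X) (ξ₀ : ℂ) (ρ : ℝ) : Prop where
  pos : 0 < ρ
  continuousOn : ContinuousOn F (ball ξ₀ ρ)
  differentiableOn : ∀ g : X →L[ℂ] ℂ, DifferentiableOn ℂ (fun ξ => g (F ξ)) (ball ξ₀ ρ)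
  map_eq : ∀ ξ ∈ ball ξ₀ ρ, T (F ξ) = Complex.exp ξ • F ξ

/-! ### Eigenvector fields and density of their spans. -/

section Eigenfield

variable {X : Type*} [AddCommGroup X] [Module ℂ X] [UniformSpace X] [IsUniformAddGroup X]
  [ContinuousSMul ℂ X] {m : ℕ} {T : X →L[ℂ] X} {U : Set (Fin m → ℂ)} {f : (Fin m → ℂ) → X}
  {φ : (Fin m → ℂ) → ℂ}

/-- With `ψ` a local inverse of `s ↦ φ (z + s • v)`, the field `F ξ = f (z + ψ (exp ξ) • v)` has
eigenvalue `exp ξ`. -/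
theorem exists_isEigenfield (hUo : IsOpen U) (hf : IsHolomorphicOn f U)
    (hφ : DifferentiableOn ℂ φ U) (hT : ∀ z ∈ U, T (f z) = φ z • f z) {z v : Fin m → ℂ}
    (hz : z ∈ U) (h0 : φ z ≠ 0) (hd : deriv (fun s : ℂ => φ (z + s • v)) 0 ≠ 0) :
    ∃ (F : ℂ → X) (ρ : ℝ), IsEigenfield T F (Complex.log (φ z)) ρ ∧
      F (Complex.log (φ z)) = f z := by
  set H : ℂ → ℂ := fun s => φ (z + s • v) with hH
  have hl : Continuous fun s : ℂ => z + s • v := by fun_prop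
  have hD : IsOpen ((fun s : ℂ => z + s • v) ⁻¹' U) := hUo.preimage hl
  have h0D : (0 : ℂ) ∈ (fun s : ℂ => z + s • v) ⁻¹' U := by simpa using hz
  have hHd : DifferentiableOn ℂ H ((fun s : ℂ => z + s • v) ⁻¹' U) :=
    hφ.comp (f := fun s : ℂ => z + s • v) (by fun_prop) (fun s hs => hs)
  have hHa : AnalyticAt ℂ H 0 := hHd.analyticAt (hD.mem_nhds h0D)
  have hH0 : H 0 = φ z := by simp [hH]
  have hstrict : HasStrictDerivAt H (deriv H 0) 0 := hHa.hasStrictDerivAt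
  obtain ⟨ψ, hψ0, hψc, hψi⟩ : ∃ ψ : ℂ → ℂ, ψ (φ z) = 0 ∧ ContDiffAt ℂ 1 ψ (φ z) ∧
      ∀ᶠ ζ in 𝓝 (φ z), H (ψ ζ) = ζ := by
    have hcd : ContDiffAt ℂ 1 H 0 := hHa.contDiffAt
    let e := ContinuousLinearEquiv.unitsEquivAut ℂ (Units.mk0 _ hd)
    have he : HasFDerivAt H (e : ℂ →L[ℂ] ℂ) 0 := by
      have := hstrict.hasDerivAt.hasFDerivAt
      convert! this using 1
    refine ⟨hcd.localInverse he one_ne_zero, ?_, ?_, ?_⟩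
    · rw [← hH0]; exact hcd.localInverse_apply_image he one_ne_zero
    · rw [← hH0]; exact hcd.to_localInverse he one_ne_zero
    · rw [← hH0]
      exact (hcd.hasStrictFDerivAt' he one_ne_zero).eventually_right_inverse
  have hexp : Complex.exp (Complex.log (φ z)) = φ z := Complex.exp_log h0
  have hψd : ∀ᶠ ζ in 𝓝 (φ z), DifferentiableAt ℂ ψ ζ := by
    filter_upwards [hψc.eventually (by simp)] with ζ hζ
    exact hζ.differentiableAt one_ne_zero
  have hψD : ∀ᶠ ζ in 𝓝 (φ z), z + ψ ζ • v ∈ U := by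
    refine hψc.continuousAt.eventually (p := fun s => z + s • v ∈ U) ?_
    rw [hψ0]; exact hD.mem_nhds h0D
  have hte : Tendsto Complex.exp (𝓝 (Complex.log (φ z))) (𝓝 (φ z)) := by
    have := Complex.continuous_exp.tendsto (Complex.log (φ z))
    rwa [hexp] at this
  obtain ⟨ρ, hρ, hb⟩ := Metric.eventually_nhds_iff_ball.1
    (hte.eventually (hψi.and (hψd.and hψD)))
  have hc : DifferentiableOn ℂ (fun ξ => z + ψ (Complex.exp ξ) • v)
      (ball (Complex.log (φ z)) ρ) := by
    intro ξ hξ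
    have h1 : DifferentiableAt ℂ (fun ξ => ψ (Complex.exp ξ)) ξ :=
      (hb ξ hξ).2.1.comp ξ Complex.differentiableAt_exp
    exact ((h1.smul_const v).const_add z).differentiableWithinAt
  have hm : MapsTo (fun ξ => z + ψ (Complex.exp ξ) • v) (ball (Complex.log (φ z)) ρ) U :=
    fun ξ hξ => (hb ξ hξ).2.2
  refine ⟨fun ξ => f (z + ψ (Complex.exp ξ) • v), ρ, ⟨hρ, ?_, ?_, ?_⟩, ?_⟩
  · exact hf.1.comp hc.continuousOn hm
  · exact fun g => (hf.2 g).comp hc hm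
  · intro ξ hξ
    rw [hT _ (hm hξ)]
    congr 1
    exact (hb ξ hξ).1
  · simp [hexp, hψ0]

theorem dense_span_eigenfield [Module ℝ X] [IsScalarTower ℝ ℂ X] [LocallyConvexSpace ℝ X]
    (hUo : IsOpen U) (hUc : IsPreconnected U)
    (hf : IsHolomorphicOn f U) (hφ : DifferentiableOn ℂ φ U)
    (hT : ∀ z ∈ U, T (f z) = φ z • f z) (hspan : Dense (Submodule.span ℂ (f '' U) : Set X))
    {σ : ℝ} (hlow : ∃ z ∈ U, ‖φ z‖ < Real.exp σ) (hhigh : ∃ z ∈ U, Real.exp σ < ‖φ z‖) :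
    Dense (Submodule.span ℂ {x : X | ∃ (F : ℂ → X) (ξ₀ : ℂ) (ρ : ℝ), IsEigenfield T F ξ₀ ρ ∧
      ξ₀.re = σ ∧ F ξ₀ = x} : Set X) := by
  refine Submodule.dense_of_forall_dual_eq_zero hspan fun g hg => ?_
  have key := eqOn_zero_of_regular_level_set hUo hUc hφ (hf.2 g) (Real.exp_pos σ) hlow hhigh
    (fun z hz v hzr hd => by
      have h0 : φ z ≠ 0 := by
        rw [← norm_pos_iff, hzr]; exact Real.exp_pos σ
      obtain ⟨F, ρ, hF, hFz⟩ := exists_isEigenfield hUo hf hφ hT hz h0 hd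
      refine hg _ (Submodule.subset_span ⟨F, _, ρ, hF, ?_, hFz⟩)
      rw [Complex.log_re, hzr, Real.log_exp])
  intro x hx
  induction hx using Submodule.span_induction with
  | mem x h => obtain ⟨z, hz, rfl⟩ := h; exact key hz
  | zero => simp
  | add x y _ _ hx hy => simp [hx, hy]
  | smul c x _ hx => simp [hx]

theorem dense_span_image_norm_lt [Module ℝ X] [IsScalarTower ℝ ℂ X] [LocallyConvexSpace ℝ X]
    (hUo : IsOpen U) (hUc : IsPreconnected U)
    (hf : IsHolomorphicOn f U) (hφ : DifferentiableOn ℂ φ U)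
    (hspan : Dense (Submodule.span ℂ (f '' U) : Set X))
    {r : ℝ} (hlow : ∃ z ∈ U, ‖φ z‖ < r) :
    Dense (Submodule.span ℂ (f '' {z ∈ U | ‖φ z‖ < r}) : Set X) := by
  refine Submodule.dense_of_forall_dual_eq_zero hspan fun g hg => ?_
  obtain ⟨z, hz, hzr⟩ := hlow
  have key := (hf.2 g).eqOn_zero_of_eventuallyEq_zero hUo hUc hz (by
    have hc : ContinuousAt (fun z => ‖φ z‖) z :=
      (hφ.differentiableAt (hUo.mem_nhds hz)).continuousAt.norm
    filter_upwards [hUo.mem_nhds hz, hc.eventually_lt_const hzr] with y hy hyr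
    exact hg _ (Submodule.subset_span ⟨y, ⟨hy, hyr⟩, rfl⟩))
  intro x hx
  induction hx using Submodule.span_induction with
  | mem x h => obtain ⟨z, hz, rfl⟩ := h; exact key hz
  | zero => simp
  | add x y _ _ hx hy => simp [hx, hy]
  | smul c x _ hx => simp [hx]

end Eigenfield

/-! ### Quadratic decay of Fourier integrals. -/

section Bump

theorem hasDerivAt_mul_sq_of_eq_zero {P G : ℂ → ℂ} {x : ℂ} (hP : DifferentiableAt ℂ P x)
    (hG : DifferentiableAt ℂ G x) (h0 : P x = 0) : HasDerivAt (fun ζ => G ζ * P ζ ^ 2) 0 x := by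
  have := hG.hasDerivAt.mul (hP.hasDerivAt.pow 2)
  convert! this using 1
  simp [h0]

/-- Two integrations by parts, each gaining a factor `1 / |t|`; the double zeros at the endpoints
remove the boundary terms. -/
theorem norm_integral_mul_exp_le_of_deriv_two {H : ℂ → ℂ} {β C t : ℝ} (hβ : 0 < β) {D : Set ℂ}
    (hD : IsOpen D) (hHD : DifferentiableOn ℂ H D) (hsub : ∀ x ∈ Icc 0 β, (x : ℂ) ∈ D)
    (h0 : H 0 = 0) (h0' : deriv H 0 = 0) (h1 : H β = 0) (h1' : deriv H β = 0)
    (hC : ∀ x ∈ Icc 0 β, ‖deriv (deriv H) (x : ℂ)‖ ≤ C) (ht : t ≠ 0) :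
    ‖∫ x in (0 : ℝ)..β, H x * Complex.exp (t * x * Complex.I)‖ ≤ β * C / t ^ 2 := by
  have htI : (t * Complex.I : ℂ) ≠ 0 := by simp [ht]
  set E : ℝ → ℂ := fun x => Complex.exp (t * x * Complex.I) with hE
  have hEc : Continuous E := by fun_prop
  have hEd : ∀ (a : ℂ) (x : ℝ), HasDerivAt (fun x : ℝ => a * E x) (a * (t * Complex.I) * E x) x := by
    intro a x
    have h2 : HasDerivAt (fun ζ : ℂ => Complex.exp (t * ζ * Complex.I))
        (Complex.exp (t * x * Complex.I) * (t * Complex.I)) x := by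
      have h3 : HasDerivAt (fun ζ : ℂ => t * ζ * Complex.I) (t * Complex.I) x := by
        simpa using ((hasDerivAt_id (x : ℂ)).const_mul (t : ℂ)).mul_const Complex.I
      exact h3.cexp
    have := (h2.comp_ofReal).const_mul a
    convert! this using 1
    simp only [hE]; ring
  have parts : ∀ K : ℂ → ℂ, DifferentiableOn ℂ K D → K 0 = 0 → K β = 0 →
      ∫ x in (0 : ℝ)..β, K x * E x =
        -((t * Complex.I)⁻¹ * ∫ x in (0 : ℝ)..β, deriv K x * E x) := by
    intro K hK hK0 hK1
    have hK' : ContinuousOn (fun x : ℝ => deriv K x) (uIcc 0 β) := by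
      rw [uIcc_of_le hβ.le]
      exact (hK.deriv hD).continuousOn.comp (f := fun x : ℝ => (x : ℂ))
        Complex.continuous_ofReal.continuousOn hsub
    have := intervalIntegral.integral_mul_deriv_eq_deriv_mul (a := 0) (b := β)
      (u := fun x : ℝ => K x) (u' := fun x : ℝ => deriv K x)
      (v := fun x => (t * Complex.I)⁻¹ * E x)
      (v' := fun x => (t * Complex.I)⁻¹ * (t * Complex.I) * E x)
      (fun x hx => by
        rw [uIcc_of_le hβ.le] at hx
        exact (hK.differentiableAt (hD.mem_nhds (hsub x hx))).hasDerivAt.comp_ofReal)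
      (fun x _ => hEd _ x) hK'.intervalIntegrable
      (Continuous.intervalIntegrable (by fun_prop) _ _)
    simp only [inv_mul_cancel₀ htI, one_mul, hK1, zero_mul, Complex.ofReal_zero, hK0, sub_zero,
      zero_sub] at this
    rw [this, ← intervalIntegral.integral_const_mul]
    congr 2
    ext x; ring
  rw [parts H hHD h0 h1, parts _ (hHD.deriv hD) h0' h1']
  have hb : ‖∫ x in (0 : ℝ)..β, deriv (deriv H) x * E x‖ ≤ C * |β - 0| := by
    refine intervalIntegral.norm_integral_le_of_norm_le_const fun x hx => ?_
    rw [uIoc_of_le hβ.le] at hx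
    rw [norm_mul, hE]
    have : ‖Complex.exp (t * x * Complex.I)‖ = 1 := by
      rw [← Complex.ofReal_mul, Complex.norm_exp_ofReal_mul_I]
    rw [this, mul_one]
    exact hC x ⟨hx.1.le, hx.2⟩
  rw [sub_zero, abs_of_pos hβ] at hb
  rw [norm_neg, norm_mul, norm_neg, norm_mul, norm_inv, norm_mul, Complex.norm_I, mul_one,
    Complex.norm_real, Real.norm_eq_abs, ← mul_assoc, ← mul_inv, abs_mul_abs_self, mul_comm,
    ← div_eq_mul_inv, ← sq]
  gcongr
  linarith

/-- Fourier integrals of a holomorphic function against a polynomial bump decay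
quadratically. -/
theorem norm_integral_bump_mul_exp_le {G : ℂ → ℂ} {β M t : ℝ} (hβ : 0 < β)
    (hG : DifferentiableOn ℂ G (ball 0 (3 * β))) (hM : ∀ ζ ∈ ball (0 : ℂ) (3 * β), ‖G ζ‖ ≤ M)
    (ht : t ≠ 0) :
    ‖∫ x in (0 : ℝ)..β, G x * ((x * (β - x) : ℂ)) ^ 2 * Complex.exp (t * x * Complex.I)‖ ≤
      288 * β ^ 3 * M / t ^ 2 := by
  set H : ℂ → ℂ := fun ζ => G ζ * (ζ * (β - ζ)) ^ 2 with hH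
  have hHD : DifferentiableOn ℂ H (ball 0 (3 * β)) := hG.mul (by fun_prop)
  have hsub : ∀ x ∈ Icc 0 β, (x : ℂ) ∈ ball (0 : ℂ) (3 * β) := by
    intro x hx
    rw [mem_ball, dist_zero_right, Complex.norm_real, Real.norm_of_nonneg hx.1]
    linarith [hx.2]
  have hG' : ∀ x ∈ Icc 0 β, DifferentiableAt ℂ G x := fun x hx =>
    hG.differentiableAt (isOpen_ball.mem_nhds (hsub x hx))
  have hM0 : 0 ≤ M := (norm_nonneg _).trans (hM 0 (mem_ball_self (by positivity)))
  have hHM : ∀ ζ ∈ ball (0 : ℂ) (3 * β), ‖H ζ‖ ≤ M * (3 * β * (4 * β)) ^ 2 := by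
    intro ζ hζ
    have h1 := hM ζ hζ
    rw [mem_ball, dist_zero_right] at hζ
    have h2 : ‖(β : ℂ) - ζ‖ ≤ 4 * β := by
      refine (norm_sub_le _ _).trans ?_
      rw [Complex.norm_real, Real.norm_of_nonneg hβ.le]; linarith
    rw [hH]
    simp only [norm_mul, norm_pow]
    gcongr
  -- The squared bump is at most `(12β²)² = 144β⁴`, and Cauchy's estimate on a circle of radius `β`
  -- costs `2 / β²`.
  have hd2 : ∀ x ∈ Icc 0 β, ‖deriv (deriv H) (x : ℂ)‖ ≤ 288 * β ^ 2 * M := by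
    intro x hx
    have hcl : closedBall (x : ℂ) β ⊆ ball 0 (3 * β) := by
      intro ζ hζ
      rw [mem_closedBall, dist_eq_norm] at hζ
      rw [mem_ball, dist_zero_right]
      have := norm_add_le (ζ - x) x
      rw [sub_add_cancel, Complex.norm_real, Real.norm_of_nonneg hx.1] at this
      linarith [hx.2]
    have := Complex.norm_iteratedDeriv_le_of_forall_mem_sphere_norm_le (n := 2) (c := x)
      (f := H) (C := M * (3 * β * (4 * β)) ^ 2) hβ
      ((hHD.mono (closure_ball_subset_closedBall.trans hcl)).diffContOnCl)
      (fun ζ hζ => hHM ζ (hcl (sphere_subset_closedBall hζ)))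
    rw [iteratedDeriv_succ, iteratedDeriv_one] at this
    refine this.trans_eq ?_
    have : β ≠ 0 := hβ.ne'
    simp only [Nat.factorial]
    push_cast
    field_simp
    ring
  have hd0 : HasDerivAt H 0 0 := hasDerivAt_mul_sq_of_eq_zero (P := fun ζ => ζ * (β - ζ))
    (by fun_prop) (by simpa using hG' 0 ⟨le_rfl, hβ.le⟩) (by simp)
  have hd1 : HasDerivAt H 0 β := hasDerivAt_mul_sq_of_eq_zero (P := fun ζ => ζ * (β - ζ))
    (by fun_prop) (hG' β ⟨hβ.le, le_rfl⟩) (by simp)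
  refine (norm_integral_mul_exp_le_of_deriv_two hβ isOpen_ball hHD hsub (by simp [hH]) hd0.deriv
    (by simp [hH]) hd1.deriv hd2 ht).trans_eq ?_
  ring

theorem integral_bump (β : ℝ) : ∫ x in (0 : ℝ)..β, (x * (β - x)) ^ 2 = β ^ 5 / 30 := by
  have : ∀ x : ℝ, (x * (β - x)) ^ 2 = β ^ 2 * x ^ 2 - 2 * β * x ^ 3 + x ^ 4 := fun x => by ring
  simp only [this]
  rw [intervalIntegral.integral_add, intervalIntegral.integral_sub]
  · simp only [intervalIntegral.integral_const_mul, integral_pow]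
    push_cast
    ring
  all_goals exact Continuous.intervalIntegrable (by fun_prop) _ _

end Bump

/-! ### Vectors concentrated at one time of the orbit. -/

section Approximable

variable {X : Type*} [AddCommGroup X] [Module ℂ X] [UniformSpace X] [IsUniformAddGroup X]
  [ContinuousSMul ℂ X]

theorem Seminorm.finsetSum_apply {ι : Type*} (s : Finset ι) (p : ι → Seminorm ℂ X) (x : X) :
    (∑ i ∈ s, p i) x = ∑ i ∈ s, p i x := by
  classical
  induction s using Finset.induction_on with
  | empty => simp
  | insert i s hi ih => rw [Finset.sum_insert hi, Finset.sum_insert hi, ← ih]; rfl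

/-- `y` is approximated, for every level `s` near `σ` and every time `n`, by images under
`exp (-n s) T ^ n` of vectors whose other iterates decay quadratically in the distance to `n`. -/
def IsBumpApproximable (T : X →L[ℂ] X) (σ : ℝ) (y : X) : Prop :=
  ∀ p : Seminorm ℂ X, Continuous p → ∀ ε > 0, ∃ η > 0, ∀ q : Seminorm ℂ X, Continuous q →
    ∃ C ≥ 0, ∀ s : ℝ, |s - σ| ≤ η → ∀ n K : ℕ, ∃ v : X,
      p (Complex.exp (-(n * s)) • (T ^ n) v - y) < ε ∧
      ∀ k ≤ K, k ≠ n → q (Complex.exp (-(k * s)) • (T ^ k) v) ≤ C / ((k : ℝ) - n) ^ 2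

variable {T : X →L[ℂ] X} {σ : ℝ}

theorem IsBumpApproximable.zero : IsBumpApproximable T σ 0 := by
  intro p _ ε hε
  refine ⟨1, one_pos, fun q _ => ⟨0, le_rfl, fun s _ n K => ⟨0, by simpa, by simp⟩⟩⟩

theorem IsBumpApproximable.add {x y : X} (hx : IsBumpApproximable T σ x)
    (hy : IsBumpApproximable T σ y) : IsBumpApproximable T σ (x + y) := by
  intro p hp ε hε
  obtain ⟨η₁, hη₁, h₁⟩ := hx p hp (ε / 2) (half_pos hε)
  obtain ⟨η₂, hη₂, h₂⟩ := hy p hp (ε / 2) (half_pos hε)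
  refine ⟨min η₁ η₂, lt_min hη₁ hη₂, fun q hq => ?_⟩
  obtain ⟨C₁, hC₁, h₁⟩ := h₁ q hq
  obtain ⟨C₂, hC₂, h₂⟩ := h₂ q hq
  refine ⟨C₁ + C₂, by positivity, fun s hs n K => ?_⟩
  obtain ⟨v, hv, hv'⟩ := h₁ s (hs.trans (min_le_left _ _)) n K
  obtain ⟨w, hw, hw'⟩ := h₂ s (hs.trans (min_le_right _ _)) n K
  refine ⟨v + w, ?_, fun k hk hkn => ?_⟩
  · rw [map_add, smul_add, add_sub_add_comm]
    exact (map_add_le_add p _ _).trans_lt (by linarith)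
  · rw [map_add, smul_add, add_div]
    exact (map_add_le_add q _ _).trans (add_le_add (hv' k hk hkn) (hw' k hk hkn))

theorem IsBumpApproximable.smul {x : X} (a : ℂ) (hx : IsBumpApproximable T σ x) :
    IsBumpApproximable T σ (a • x) := by
  intro p hp ε hε
  have ha : 0 < ‖a‖ + 1 := by positivity
  obtain ⟨η, hη, h⟩ := hx p hp (ε / (‖a‖ + 1)) (div_pos hε ha)
  refine ⟨η, hη, fun q hq => ?_⟩
  obtain ⟨C, hC, h⟩ := h q hq
  refine ⟨‖a‖ * C, by positivity, fun s hs n K => ?_⟩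
  obtain ⟨v, hv, hv'⟩ := h s hs n K
  refine ⟨a • v, ?_, fun k hk hkn => ?_⟩
  · rw [map_smul, smul_comm, ← smul_sub, map_smul_eq_mul]
    rw [lt_div_iff₀ ha] at hv
    nlinarith [apply_nonneg p (Complex.exp (-(n * s)) • (T ^ n) v - x)]
  · rw [map_smul (T ^ k), smul_comm, map_smul_eq_mul, mul_div_assoc]
    exact mul_le_mul_of_nonneg_left (hv' k hk hkn) (norm_nonneg a)

/-- Limits are allowed because `η` and `C` may depend on `p` and `ε`, hence on the approximant. -/
theorem IsBumpApproximable.of_forall_exists_lt {y : X}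
    (h : ∀ p : Seminorm ℂ X, Continuous p → ∀ ε > 0, ∃ x, p (x - y) < ε ∧
      IsBumpApproximable T σ x) : IsBumpApproximable T σ y := by
  intro p hp ε hε
  obtain ⟨x, hxy, hx⟩ := h p hp (ε / 2) (half_pos hε)
  obtain ⟨η, hη, h⟩ := hx p hp (ε / 2) (half_pos hε)
  refine ⟨η, hη, fun q hq => ?_⟩
  obtain ⟨C, hC, h⟩ := h q hq
  refine ⟨C, hC, fun s hs n K => ?_⟩
  obtain ⟨v, hv, hv'⟩ := h s hs n K
  refine ⟨v, ?_, hv'⟩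
  rw [← sub_add_sub_cancel _ x]
  exact (map_add_le_add p _ _).trans_lt (by linarith)

theorem IsEigenfield.pow_map_eq {F : ℂ → X} {ξ₀ : ℂ} {ρ : ℝ} (hF : IsEigenfield T F ξ₀ ρ) {ξ : ℂ}
    (hξ : ξ ∈ ball ξ₀ ρ) (k : ℕ) : (T ^ k) (F ξ) = Complex.exp (k * ξ) • F ξ := by
  induction k with
  | zero => simp
  | succ k ih =>
    rw [pow_succ', mul_apply_eq_comp, ih, map_smul, hF.map_eq ξ hξ, smul_smul,
      ← Complex.exp_add]
    push_cast
    ring_nf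

/-- With `θ = im ξ₀`, `v` approximates the weak integral of `c⁻¹ (x(β-x))² e^(-in(θ+x)) F(s +
i(θ+x))`. Applying `e^(-ks) T^k` changes the phase to `e^(i(k-n)(θ+x))`: for `k = n` an average of
`F` near `ξ₀` remains, otherwise a Fourier integral of frequency `k - n`. -/
theorem IsEigenfield.isBumpApproximable [PolynormableSpace ℂ X] {F : ℂ → X} {ξ₀ : ℂ} {ρ : ℝ}
    (hF : IsEigenfield T F ξ₀ ρ) : IsBumpApproximable T ξ₀.re (F ξ₀) := by
  intro p hp ε hε
  obtain ⟨ρ', hρ', hρ'ρ, hpF⟩ : ∃ ρ' > 0, ρ' < ρ ∧ ∀ ξ ∈ ball ξ₀ ρ', p (F ξ - F ξ₀) < ε / 2 := by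
    have hc : ContinuousAt F ξ₀ := hF.continuousOn.continuousAt (ball_mem_nhds _ hF.pos)
    have hc' : ContinuousAt (fun ξ => p (F ξ - F ξ₀)) ξ₀ :=
      hp.continuousAt.comp (hc.sub continuousAt_const)
    have hlt : p (F ξ₀ - F ξ₀) < ε / 2 := by simpa using hε
    obtain ⟨r, hr, h⟩ := Metric.eventually_nhds_iff_ball.1 (hc'.eventually_lt_const hlt)
    refine ⟨min r (ρ / 2), lt_min hr (half_pos hF.pos), ?_, fun ξ hξ => ?_⟩
    · exact (min_le_right _ _).trans_lt (half_lt_self hF.pos)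
    · exact h ξ (ball_subset_ball (min_le_left _ _) hξ)
  -- If `|s - re ξ₀| ≤ ρ'/8` and `|ζ| < 3β`, then `ξ ζ` is within `5ρ'/16 < ρ'/2` of `ξ₀`. The
  -- constant `c` is the integral of the bump.
  set β : ℝ := ρ' / 16 with hβ
  have hβ0 : 0 < β := by positivity
  set c : ℝ := β ^ 5 / 30 with hc
  have hc0 : 0 < c := by positivity
  refine ⟨ρ' / 8, by positivity, fun q hq => ?_⟩
  obtain ⟨M, hM⟩ : ∃ M, ∀ ξ ∈ closedBall ξ₀ (ρ' / 2), q (F ξ) ≤ M := by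
    have hcont : ContinuousOn (fun ξ => q (F ξ)) (closedBall ξ₀ (ρ' / 2)) :=
      hq.comp_continuousOn (hF.continuousOn.mono (closedBall_subset_ball (by linarith)))
    obtain ⟨M, hM⟩ := (isCompact_closedBall ξ₀ (ρ' / 2)).bddAbove_image hcont
    exact ⟨M, fun ξ hξ => hM ⟨ξ, hξ, rfl⟩⟩
  have hM0 : 0 ≤ M := (apply_nonneg q _).trans (hM ξ₀ (mem_closedBall_self (by positivity)))
  refine ⟨c⁻¹ * (288 * β ^ 3 * M) + 1, by positivity, fun s hs n K => ?_⟩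
  set ξ : ℂ → ℂ := fun ζ => s + (ξ₀.im + ζ) * Complex.I with hξdef
  have hξ : ∀ ζ ∈ ball (0 : ℂ) (3 * β), ξ ζ ∈ ball ξ₀ (ρ' / 2) := by
    intro ζ hζ
    rw [mem_ball, dist_zero_right] at hζ
    have e : ξ ζ - ξ₀ = ((s - ξ₀.re : ℝ) : ℂ) + ζ * Complex.I := by
      apply Complex.ext <;> simp [hξdef, sub_eq_add_neg, add_right_comm]
    rw [mem_ball, dist_eq_norm, e]
    refine (norm_add_le _ _).trans_lt ?_
    rw [norm_mul, Complex.norm_I, mul_one, Complex.norm_real, Real.norm_eq_abs]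
    linarith
  have hball : ball ξ₀ (ρ' / 2) ⊆ ball ξ₀ ρ := ball_subset_ball (by linarith)
  have hξd : Differentiable ℂ ξ := by fun_prop
  have hsub : ∀ x ∈ Icc 0 β, (x : ℂ) ∈ ball (0 : ℂ) (3 * β) := by
    intro x hx
    rw [mem_ball, dist_zero_right, Complex.norm_real, Real.norm_of_nonneg hx.1]
    linarith [hx.2]
  set J : ℝ → X := fun x =>
    (((c⁻¹ * (x * (β - x)) ^ 2 : ℝ) : ℂ) * Complex.exp (-(n * (ξ₀.im + x)) * Complex.I)) • F (ξ x)
    with hJ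
  have hFc : ContinuousOn (fun x : ℝ => F (ξ x)) (Icc 0 β) :=
    hF.continuousOn.comp (f := fun x : ℝ => ξ x)
      (hξd.continuous.comp Complex.continuous_ofReal).continuousOn
      (fun x hx => hball (hξ x (hsub x hx)))
  have hJc : ContinuousOn J (Icc 0 β) := by
    refine ContinuousOn.smul (Continuous.continuousOn (by fun_prop)) hFc
  set A : ℕ → X →L[ℂ] X := fun k => Complex.exp (-(k * s)) • T ^ k with hA
  -- One seminorm controls all iterates up to the horizon, so a single `v` serves them all; this is
  -- why `K` must be fixed beforehand.
  set P : Seminorm ℂ X := ∑ k ∈ Finset.range (K + n + 1), (p + q).comp (A k).toLinearMap with hP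
  have hPx : ∀ x, P x = ∑ k ∈ Finset.range (K + n + 1), (p (A k x) + q (A k x)) := by
    intro x
    rw [hP, Seminorm.finsetSum_apply]
    rfl
  have hPc : Continuous P := by
    have : (P : X → ℝ) = fun x => ∑ k ∈ Finset.range (K + n + 1), (p (A k x) + q (A k x)) :=
      funext hPx
    rw [this]
    exact continuous_finsetSum _ fun k _ =>
      (hp.comp (A k).continuous).add (hq.comp (A k).continuous)
  -- The second bound is at most `1 / (k - n)²`, which the `+ 1` in the decay constant absorbs.
  set δ : ℝ := min (ε / 4) (1 / (K + n + 1) ^ 2) with hδ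
  have hδ0 : 0 < δ := lt_min (by positivity) (by positivity)
  obtain ⟨v, hv⟩ := exists_forall_norm_sub_integral_le hβ0 hJc hPc hδ0
  have hPk : ∀ k ≤ K + n, ∀ x, p (A k x) + q (A k x) ≤ P x := by
    intro k hk x
    rw [hPx]
    exact Finset.single_le_sum (f := fun k => p (A k x) + q (A k x))
      (fun i _ => add_nonneg (apply_nonneg _ _) (apply_nonneg _ _))
      (Finset.mem_range.2 (by omega))
  have hAJ : ∀ k, ∀ g : X →L[ℂ] ℂ, ∀ x ∈ Icc 0 β, g (A k (J x)) =
      ((c⁻¹ : ℝ) : ℂ) * Complex.exp (((k : ℝ) - n : ℝ) * ξ₀.im * Complex.I) *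
        (g (F (ξ x)) * (x * (β - x) : ℂ) ^ 2 *
          Complex.exp (((k : ℝ) - n : ℝ) * x * Complex.I)) := by
    intro k g x hx
    simp only [hA, hJ, smul_apply, map_smul,
      hF.pow_map_eq (hball (hξ x (hsub x hx))), smul_eq_mul]
    have e : Complex.exp (-(k * s)) * (Complex.exp (-(n * (ξ₀.im + x)) * Complex.I) *
        Complex.exp (k * ξ x)) = Complex.exp (((k : ℝ) - n : ℝ) * ξ₀.im * Complex.I) *
          Complex.exp (((k : ℝ) - n : ℝ) * x * Complex.I) := by
      rw [← Complex.exp_add, ← Complex.exp_add, ← Complex.exp_add]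
      congr 1
      simp only [hξdef]
      push_cast
      ring
    push_cast at e ⊢
    linear_combination ((c : ℂ)⁻¹ * (x * (β - x)) ^ 2 * g (F (ξ x))) * e
  refine ⟨v, ?_, fun k hk hkn => ?_⟩
  · refine lt_of_le_of_lt (Seminorm.le_of_forall_dual_le hp (c := ε / 4 + ε / 2) fun g hg => ?_)
      (by linarith)
    have h1 := hv (g.comp (A n)) fun x =>
      (hg _).trans (le_trans (le_add_of_nonneg_right (apply_nonneg q _)) (hPk n (by omega) x))
    have hint : ∫ x in (0 : ℝ)..β, ((c⁻¹ * (x * (β - x)) ^ 2 : ℝ) : ℂ) * g (F ξ₀) = g (F ξ₀) := by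
      rw [intervalIntegral.integral_mul_const, intervalIntegral.integral_ofReal,
        intervalIntegral.integral_const_mul, integral_bump, ← hc, inv_mul_cancel₀ hc0.ne']
      simp
    have hgc : ContinuousOn (fun x : ℝ => g (F (ξ x))) (uIcc 0 β) := by
      rw [uIcc_of_le hβ0.le]; exact g.continuous.comp_continuousOn hFc
    have h2 : ∫ x in (0 : ℝ)..β, (g.comp (A n)) (J x) =
        ∫ x in (0 : ℝ)..β, ((c⁻¹ * (x * (β - x)) ^ 2 : ℝ) : ℂ) * g (F (ξ x)) := by
      refine intervalIntegral.integral_congr fun x hx => ?_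
      rw [uIcc_of_le hβ0.le] at hx
      simp only [ContinuousLinearMap.comp_apply, hAJ n g x hx]
      simp
      ring
    have h3 : ‖(∫ x in (0 : ℝ)..β, (g.comp (A n)) (J x)) - g (F ξ₀)‖ ≤ ε / 2 := by
      rw [h2]
      nth_rewrite 1 [← hint]
      have hi1 : IntervalIntegrable
          (fun x : ℝ => ((c⁻¹ * (x * (β - x)) ^ 2 : ℝ) : ℂ) * g (F (ξ x)))
          MeasureTheory.volume 0 β :=
        ContinuousOn.intervalIntegrable
          (ContinuousOn.mul (Continuous.continuousOn (by fun_prop)) hgc)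
      have hi2 : IntervalIntegrable
          (fun x : ℝ => ((c⁻¹ * (x * (β - x)) ^ 2 : ℝ) : ℂ) * g (F ξ₀))
          MeasureTheory.volume 0 β := Continuous.intervalIntegrable (by fun_prop) _ _
      rw [← intervalIntegral.integral_sub hi1 hi2]
      have e : ∫ x in (0 : ℝ)..β, c⁻¹ * (x * (β - x)) ^ 2 * (ε / 2) = ε / 2 := by
        rw [intervalIntegral.integral_mul_const, intervalIntegral.integral_const_mul,
          integral_bump, ← hc, inv_mul_cancel₀ hc0.ne', one_mul]
      rw [← e]
      refine intervalIntegral.norm_integral_le_of_norm_le hβ0.le ?_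
        (Continuous.intervalIntegrable (by fun_prop) _ _)
      refine Filter.Eventually.of_forall fun x hx => ?_
      have hnn : 0 ≤ c⁻¹ * (x * (β - x)) ^ 2 := by positivity
      rw [← mul_sub, norm_mul, Complex.norm_real, Real.norm_of_nonneg hnn, ← map_sub]
      exact mul_le_mul_of_nonneg_left ((hg _).trans
        (hpF _ (ball_subset_ball (by linarith) (hξ x (hsub x ⟨hx.1.le, hx.2⟩)))).le) hnn
    have h4 : g (Complex.exp (-(n * s)) • (T ^ n) v - F ξ₀) =
        ((g.comp (A n)) v - ∫ x in (0 : ℝ)..β, (g.comp (A n)) (J x)) +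
          ((∫ x in (0 : ℝ)..β, (g.comp (A n)) (J x)) - g (F ξ₀)) := by
      rw [sub_add_sub_cancel, map_sub]
      rfl
    rw [h4]
    exact (norm_add_le _ _).trans (add_le_add (h1.trans (min_le_left _ _)) h3)
  · refine Seminorm.le_of_forall_dual_le hq fun g hg => ?_
    have h1 := hv (g.comp (A k)) fun x =>
      (hg _).trans (le_trans (le_add_of_nonneg_left (apply_nonneg p _)) (hPk k (by omega) x))
    have hkn' : (k : ℝ) - n ≠ 0 := sub_ne_zero.2 (by exact_mod_cast hkn)
    have h2 : ∫ x in (0 : ℝ)..β, (g.comp (A k)) (J x) =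
        ((c⁻¹ : ℝ) : ℂ) * Complex.exp (((k : ℝ) - n : ℝ) * ξ₀.im * Complex.I) *
        ∫ x in (0 : ℝ)..β, (g (F (ξ x)) * (x * (β - x) : ℂ) ^ 2 *
          Complex.exp (((k : ℝ) - n : ℝ) * x * Complex.I)) := by
      rw [← intervalIntegral.integral_const_mul]
      refine intervalIntegral.integral_congr fun x hx => ?_
      rw [uIcc_of_le hβ0.le] at hx
      exact hAJ k g x hx
    have h3 := norm_integral_bump_mul_exp_le (G := fun ζ => g (F (ξ ζ))) hβ0
      ((hF.differentiableOn g).comp hξd.differentiableOn fun ζ hζ => hball (hξ ζ hζ))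
      (fun ζ hζ => (hg _).trans (hM _ (ball_subset_closedBall (hξ ζ hζ)))) hkn'
    have h4 : ‖∫ x in (0 : ℝ)..β, (g.comp (A k)) (J x)‖ ≤
        c⁻¹ * (288 * β ^ 3 * M) / ((k : ℝ) - n) ^ 2 := by
      rw [h2, norm_mul, norm_mul, Complex.norm_real, ← Complex.ofReal_mul,
        Complex.norm_exp_ofReal_mul_I, mul_one, Real.norm_of_nonneg (by positivity), mul_div_assoc]
      exact mul_le_mul_of_nonneg_left h3 (by positivity)
    have h5 : δ ≤ 1 / ((k : ℝ) - n) ^ 2 := by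
      refine (min_le_right _ _).trans ?_
      refine one_div_le_one_div_of_le (by positivity) ?_
      refine sq_le_sq' ?_ ?_
      · have : (n : ℝ) ≤ n := le_rfl
        have h6 : (0 : ℝ) ≤ k := by positivity
        have h7 : (0 : ℝ) ≤ K := by positivity
        linarith
      · have h6 : (k : ℝ) ≤ K := by exact_mod_cast hk
        have h7 : (0 : ℝ) ≤ n := by positivity
        linarith
    rw [add_div]
    have h6 : g (Complex.exp (-(k * s)) • (T ^ k) v) =
        (∫ x in (0 : ℝ)..β, (g.comp (A k)) (J x)) +
        ((g.comp (A k)) v - ∫ x in (0 : ℝ)..β, (g.comp (A k)) (J x)) := by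
      rw [add_sub_cancel]; rfl
    rw [h6]
    exact (norm_add_le _ _).trans (add_le_add h4 (h1.trans h5))

theorem isBumpApproximable_of_dense_span [PolynormableSpace ℂ X]
    (h : Dense (Submodule.span ℂ {x : X | ∃ (F : ℂ → X) (ξ₀ : ℂ) (ρ : ℝ), IsEigenfield T F ξ₀ ρ ∧
      ξ₀.re = σ ∧ F ξ₀ = x} : Set X)) (y : X) : IsBumpApproximable T σ y := by
  refine IsBumpApproximable.of_forall_exists_lt fun p hp ε hε => ?_
  have ho : IsOpen {x | p (x - y) < ε} := isOpen_lt (by fun_prop) continuous_const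
  obtain ⟨x, hxS, hx⟩ := h.exists_mem_open ho ⟨y, by simpa using hε⟩
  refine ⟨x, hx, ?_⟩
  clear hx
  induction hxS using Submodule.span_induction with
  | mem x h => obtain ⟨F, ξ₀, ρ, hF, rfl, rfl⟩ := h; exact hF.isBumpApproximable
  | zero => exact .zero
  | add x y _ _ hx hy => exact hx.add hy
  | smul c x _ hx => exact hx.smul c

end Approximable

/-! ### Phases, inverse-square sums and logarithmic levels. -/

theorem norm_exp_two_pi_mul_I_sub_one_le (x : ℝ) (k : ℤ) :
    ‖Complex.exp ((2 * Real.pi * x : ℝ) * Complex.I) - 1‖ ≤ 2 * Real.pi * |x - k| := by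
  have e : Complex.exp ((2 * Real.pi * x : ℝ) * Complex.I) =
      Complex.exp (Complex.I * (2 * Real.pi * (x - k) : ℝ)) := by
    rw [← Complex.exp_periodic.int_mul k (Complex.I * (2 * Real.pi * (x - k) : ℝ))]
    congr 1
    push_cast
    ring
  rw [e]
  refine (Real.norm_exp_I_mul_ofReal_sub_one_le).trans_eq ?_
  rw [Real.norm_eq_abs, abs_mul, abs_of_pos Real.two_pi_pos]

/-- A finite sequence of phases which meets, up to `δ`, the inverse of every geometric progression
on the unit circle. -/
theorem exists_phases {δ : ℝ} (hδ : 0 < δ) : ∃ (B : ℕ) (χ : ℕ → ℝ), ∀ a b : ℝ, ∃ i < B,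
    ‖Complex.exp ((2 * Real.pi * (a + i * b + χ i) : ℝ) * Complex.I) - 1‖ < δ := by
  obtain ⟨L, hL⟩ := exists_nat_gt (4 * Real.pi / δ)
  have hL0 : (0 : ℝ) < L := lt_of_le_of_lt (by positivity) hL
  have hLpos : 0 < L := by exact_mod_cast hL0
  set S := L ^ 2 with hS
  have hSpos : 0 < S := by positivity
  set D := S * L + 1 with hD
  -- Dirichlet gives `s ≤ S` with `s b` within `1 / (S + 1)` of an integer. Along the indices `s D +
  -- l s`, `l ≤ L`, the progression is then constant modulo 1 up to `1 / L`, while `χ` takes the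
  -- value `l / L`. The choice of `D` ensures `l s < D`, so `s` and `l` can be read off the index.
  refine ⟨(S + 1) * D, fun i => (((i % D) / (i / D) : ℕ) : ℝ) / L, fun a b => ?_⟩
  obtain ⟨s, hs0, hsS, hs⟩ := Real.exists_nat_abs_mul_sub_round_le b hSpos
  set a' : ℝ := a + s * D * b with ha'
  set l := ⌊(1 - Int.fract a') * L⌋₊ with hl
  have hfr0 := Int.fract_nonneg a'
  have hfr1 := Int.fract_lt_one a'
  have hl1 : (l : ℝ) ≤ (1 - Int.fract a') * L :=
    Nat.floor_le (mul_nonneg (by linarith) hL0.le)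
  have hl2 : (1 - Int.fract a') * L < l + 1 := Nat.lt_floor_add_one _
  have hlL : l ≤ L := by
    have : (l : ℝ) ≤ L := hl1.trans (by nlinarith)
    exact_mod_cast this
  have hlt : l * s < D := by
    have := Nat.mul_le_mul hlL hsS
    rw [hD]; linarith [mul_comm L S]
  refine ⟨s * D + l * s, ?_, ?_⟩
  · calc s * D + l * s < s * D + D := by omega
      _ = (s + 1) * D := by ring
      _ ≤ (S + 1) * D := Nat.mul_le_mul_right _ (by omega)
  have hmod : (s * D + l * s) % D = l * s := by
    rw [add_comm, Nat.add_mul_mod_self_right, Nat.mod_eq_of_lt hlt]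
  have hdiv : (s * D + l * s) / D = s := by
    rw [add_comm, Nat.add_mul_div_right _ _ (by omega), Nat.div_eq_of_lt hlt, zero_add]
  simp only [hmod, hdiv, Nat.mul_div_cancel _ hs0]
  refine (norm_exp_two_pi_mul_I_sub_one_le _ (⌊a'⌋ + 1 + l * round (s * b))).trans_lt ?_
  have h1 : |a' + l / L - (⌊a'⌋ + 1)| ≤ 1 / L := by
    have e : a' + l / L - (⌊a'⌋ + 1) = (l - (1 - Int.fract a') * L) / L := by
      rw [Int.fract]; field_simp; ring
    rw [e, abs_div, abs_of_pos hL0]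
    gcongr
    rw [abs_le]; constructor <;> linarith
  have h2 : |l * (s * b - round (s * b))| ≤ 1 / L := by
    rw [abs_mul, abs_of_nonneg (Nat.cast_nonneg l)]
    calc (l : ℝ) * |s * b - round (s * b)| ≤ L * (1 / (S + 1)) := by
          gcongr
      _ ≤ 1 / L := by
          rw [hS, mul_one_div, div_le_div_iff₀ (by positivity) hL0]
          push_cast
          nlinarith
  have h3 : a + ((s * D + l * s : ℕ) : ℝ) * b + l / L -
      ((⌊a'⌋ + 1 + l * round (s * b) : ℤ) : ℝ) =
      (a' + l / L - (⌊a'⌋ + 1)) + l * (s * b - round (s * b)) := by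
    rw [ha']; push_cast; ring
  rw [h3]
  have h4 := (abs_add_le _ _).trans (add_le_add h1 h2)
  calc _ ≤ 2 * Real.pi * (1 / L + 1 / L) := by gcongr
    _ = 4 * Real.pi / L := by ring
    _ < δ := by rw [div_lt_iff₀ hL0]; rw [div_lt_iff₀ hδ] at hL; linarith

theorem sum_inv_sq_le (n : ℕ) : ∑ i ∈ Finset.range n, 1 / ((i : ℝ) + 1) ^ 2 ≤ 2 := by
  have : ∑ i ∈ Finset.range n, 1 / ((i : ℝ) + 1) ^ 2 ≤ 2 - 1 / (n : ℝ) := by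
    induction n with
    | zero => norm_num
    | succ n ih =>
      rw [Finset.sum_range_succ]
      rcases Nat.eq_zero_or_pos n with rfl | hn
      · norm_num
      · have hn' : (0 : ℝ) < n := by exact_mod_cast hn
        have h : 1 / ((n : ℝ) + 1) ^ 2 ≤ 1 / n - 1 / (n + 1) := by
          rw [div_sub_div _ _ hn'.ne' (by positivity), div_le_div_iff₀ (by positivity)
            (by positivity)]
          nlinarith
        push_cast
        linarith
  have h : (0 : ℝ) ≤ 1 / (n : ℝ) := by positivity
  linarith

/-- The term `j = k` is `1 / 0 = 0`, so it need not be excluded. -/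
theorem sum_inv_sub_sq_le (s : Finset ℕ) (k : ℕ) : ∑ j ∈ s, 1 / ((j : ℝ) - k) ^ 2 ≤ 4 := by
  obtain ⟨n, hn⟩ : ∃ n, s ⊆ Finset.range (k + 1 + n) :=
    ⟨s.sup id + 1, fun j hj => Finset.mem_range.2 (by
      have := Finset.le_sup (f := id) hj
      simp only [id] at this
      omega)⟩
  refine (Finset.sum_le_sum_of_subset_of_nonneg hn fun _ _ _ => by positivity).trans ?_
  rw [Finset.sum_range_add, Finset.sum_range_succ, ← Finset.sum_range_reflect]
  have h1 : ∑ j ∈ Finset.range k, 1 / (((k - 1 - j : ℕ) : ℝ) - k) ^ 2 ≤ 2 := by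
    refine le_trans (le_of_eq (Finset.sum_congr rfl fun j hj => ?_)) (sum_inv_sq_le k)
    have hj := Finset.mem_range.1 hj
    rw [Nat.sub_sub, Nat.cast_sub (by omega)]
    push_cast
    congr 1
    ring
  have h2 : ∑ j ∈ Finset.range n, 1 / (((k + 1 + j : ℕ) : ℝ) - k) ^ 2 ≤ 2 := by
    refine le_trans (le_of_eq (Finset.sum_congr rfl fun j _ => ?_)) (sum_inv_sq_le n)
    push_cast
    congr 1
    ring
  have h3 : 1 / ((k : ℝ) - k) ^ 2 = 0 := by simp
  linarith

theorem exists_logarithmic_block {κ A P W : ℝ} (hκ : 0 < κ) (hP : 0 < P) {m₀ : ℕ}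
    (hW : W ≤ A - κ * Real.log (m₀ * P)) :
    ∃ m ≥ m₀, A - κ * Real.log ((m + 1 : ℕ) * P) < W ∧ W ≤ A - κ * Real.log (m * P) := by
  have ht : Tendsto (fun m : ℕ => A - κ * Real.log (m * P)) atTop atBot := by
    have h1 : Tendsto (fun m : ℕ => κ * Real.log (m * P)) atTop atTop :=
      (Real.tendsto_log_atTop.comp
        (tendsto_natCast_atTop_atTop.atTop_mul_const hP)).const_mul_atTop hκ
    simpa [sub_eq_add_neg] using tendsto_atBot_add_const_left atTop A (tendsto_neg_atTop_atBot.comp h1)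
  have hex : ∃ m ≥ m₀, A - κ * Real.log (m * P) < W :=
    ((eventually_ge_atTop m₀).and (ht.eventually_lt_atBot W)).exists
  classical
  have hspec := Nat.find_spec hex
  have hne : Nat.find hex ≠ m₀ := fun h => by
    rw [h] at hspec; linarith [hspec.2]
  have hlt : m₀ < Nat.find hex := lt_of_le_of_ne hspec.1 (Ne.symm hne)
  refine ⟨Nat.find hex - 1, by omega, ?_, ?_⟩
  · rw [Nat.sub_add_cancel (by omega)]; exact hspec.2
  · have := Nat.find_min hex (m := Nat.find hex - 1) (by omega)
    push Not at this
    exact this (by omega)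

/-- The graph of the concave function `-x log x` lies below its tangent at `y`. -/
theorem mul_log_sub_log_add_sub_nonpos {x y : ℝ} (hx : 0 < x) (hy : 0 < y) :
    x * (Real.log y - Real.log x) + (x - y) ≤ 0 := by
  have h := Real.log_le_sub_one_of_pos (div_pos hy hx)
  rw [Real.log_div hy.ne' hx.ne'] at h
  have h2 := mul_le_mul_of_nonneg_left h hx.le
  have h3 : x * (y / x - 1) = y - x := by field_simp
  linarith

/-! ### One vector approximating a target for a whole annulus of multiples. -/

section Simultaneous

variable {X : Type*} [AddCommGroup X] [Module ℂ X] [UniformSpace X] [IsUniformAddGroup X]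
  [ContinuousSMul ℂ X] {T : X →L[ℂ] X}

theorem norm_pow_mul_exp_sub_one_le {w : ℂ} (hw : w ≠ 0) {n : ℕ} {l θ δ δ₁ : ℝ}
    (hδ₁ : 4 * δ₁ ≤ 1) (hl : |n * (Real.log ‖w‖ - l)| ≤ 2 * δ₁)
    (hθ : ‖Complex.exp ((n * Complex.arg w + θ : ℝ) * Complex.I) - 1‖ ≤ δ) :
    ‖w ^ n * Complex.exp (-(n * l))‖ ≤ 2 ∧
    ‖w ^ n * Complex.exp (-(n * l)) * Complex.exp (θ * Complex.I) - 1‖ ≤ 2 * δ + 4 * δ₁ := by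
  set x : ℝ := n * (Real.log ‖w‖ - l) with hx
  have hlog : Complex.exp (Real.log ‖w‖ + Complex.arg w * Complex.I) = w := by
    have := Complex.exp_log hw
    rwa [Complex.log] at this
  have e : w ^ n * Complex.exp (-(n * l)) =
      Real.exp x * Complex.exp ((n * Complex.arg w : ℝ) * Complex.I) := by
    nth_rewrite 1 [← hlog]
    rw [← Complex.exp_nat_mul, ← Complex.exp_add, Complex.ofReal_exp, ← Complex.exp_add]
    congr 1
    rw [hx]; push_cast; ring
  have h1 : |Real.exp x - 1| ≤ 4 * δ₁ :=
    (Real.abs_exp_sub_one_le (hl.trans (by linarith))).trans (by linarith)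
  have h2 : Real.exp x ≤ 2 := by linarith [(abs_le.1 h1).2]
  have hn : ‖(Real.exp x : ℂ)‖ = Real.exp x := by
    rw [Complex.norm_real, Real.norm_of_nonneg (Real.exp_pos x).le]
  constructor
  · rw [e, norm_mul, Complex.norm_exp_ofReal_mul_I, mul_one, hn]
    exact h2
  · set E : ℂ := Complex.exp ((n * Complex.arg w + θ : ℝ) * Complex.I) with hE
    have e2 : w ^ n * Complex.exp (-(n * l)) * Complex.exp (θ * Complex.I) - 1 =
        Real.exp x * (E - 1) + ((Real.exp x - 1 : ℝ) : ℂ) := by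
      rw [e, mul_assoc, ← Complex.exp_add, ← add_mul, ← Complex.ofReal_add, ← hE]
      push_cast; ring
    rw [e2]
    refine (norm_add_le _ _).trans (add_le_add ?_ ?_)
    · rw [norm_mul, hn]
      exact mul_le_mul h2 hθ (norm_nonneg _) two_pos.le
    · rw [Complex.norm_real]; exact h1

/-- Over the block the logarithm grows by at most `1 / m`, while `x ≤ (m + 1) P`; the product stays
bounded by `κ P (m + 1) / m`. -/
theorem abs_mul_sub_log_le {κ A P δ₁ W x : ℝ} {m : ℕ} (hκ : 0 < κ) (hP : 0 < P) (hm : 1 ≤ m)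
    (hδ₁ : κ * P ≤ δ₁) (h1 : A - κ * Real.log ((m + 1 : ℕ) * P) < W)
    (h2 : W ≤ A - κ * Real.log (m * P)) (hx1 : m * P ≤ x) (hx2 : x ≤ (m + 1 : ℕ) * P) :
    |x * (W - (A - κ * Real.log x))| ≤ 2 * δ₁ ∧ |W - (A - κ * Real.log x)| ≤ κ := by
  have hm0 : (1 : ℝ) ≤ m := by exact_mod_cast hm
  have hmP : 0 < m * P := by positivity
  have hx0 : 0 < x := hmP.trans_le hx1
  have hl1 := Real.log_le_log hmP hx1
  have hl2 := Real.log_le_log hx0 hx2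
  have hlog : Real.log ((m + 1 : ℕ) * P) - Real.log (m * P) ≤ 1 / m := by
    rw [← Real.log_div (by positivity) (by positivity)]
    refine (Real.log_le_sub_one_of_pos (by positivity)).trans_eq ?_
    push_cast
    field_simp
    ring
  have hd : |W - (A - κ * Real.log x)| ≤ κ * (1 / m) := by
    have h3 := mul_le_mul_of_nonneg_left hlog hκ.le
    have h4 := mul_le_mul_of_nonneg_left hl1 hκ.le
    have h5 := mul_le_mul_of_nonneg_left hl2 hκ.le
    rw [abs_le]
    constructor <;> linarith
  constructor
  · rw [abs_mul, abs_of_pos hx0]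
    have hx2' : x ≤ (m + 1) * P := by simpa using hx2
    calc x * |W - (A - κ * Real.log x)| ≤ ((m + 1) * P) * (κ * (1 / m)) := by gcongr
      _ = κ * P * ((m + 1) / m) := by field_simp
      _ ≤ δ₁ * 2 := by
        have : ((m : ℝ) + 1) / m ≤ 2 := by
          rw [div_le_iff₀ (by positivity)]; linarith
        have h0 : 0 ≤ κ * P := by positivity
        gcongr
        exact h0.trans hδ₁
      _ = 2 * δ₁ := by ring
  · refine hd.trans ?_
    have : 1 / (m : ℝ) ≤ 1 := by rw [div_le_one (by positivity)]; exact hm0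
    nlinarith

set_option maxHeartbeats 1000000 in
theorem exists_simultaneous_approx {σ τ : ℝ} {y : X} (hτ : τ < σ)
    (hy : IsBumpApproximable T σ y)
    (hdec : ∀ (x : X) (q : Seminorm ℂ X), Continuous q → ∀ ε > 0, ∃ x', q (x' - x) < ε ∧
      ∀ p : Seminorm ℂ X, Continuous p → ∃ C ≥ 0, ∀ n : ℕ, p ((T ^ n) x') ≤ C * Real.exp (n * τ))
    {p : Seminorm ℂ X} (hp : Continuous p) {ε : ℝ} (hε : 0 < ε) :
    ∃ η > 0, ∀ (x₀ : X) (q : Seminorm ℂ X), Continuous q → ∀ ε' > 0, ∃ u : X, q (u - x₀) < ε' ∧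
      ∀ w : ℂ, w ≠ 0 → |Real.log ‖w‖ + σ| ≤ η → ∃ n : ℕ, p (w ^ n • (T ^ n) u - y) < ε := by
  obtain ⟨η₀, hη₀, hbump⟩ := hy p hp (ε / 16) (by positivity)
  -- The levels `κ - l` will stay within `3η` of `σ`, and `2η ≤ σ - τ` makes the iterates of `x'`
  -- decay like `e^(-nη)` at every level `l ≤ -σ + η`.
  set η : ℝ := min (η₀ / 3) ((σ - τ) / 2) with hη
  have hη_pos : 0 < η := lt_min (by positivity) (by linarith)
  have hη1 : 3 * η ≤ η₀ := by linarith [min_le_left (η₀ / 3) ((σ - τ) / 2)]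
  have hη2 : 2 * η ≤ σ - τ := by linarith [min_le_right (η₀ / 3) ((σ - τ) / 2)]
  refine ⟨η, hη_pos, fun x₀ q hq ε' hε' => ?_⟩
  have hY : 0 ≤ p y := apply_nonneg p y
  set δ : ℝ := ε / (16 * (p y + 1)) with hδ
  have hδ_pos : 0 < δ := by positivity
  have hδY : δ * p y ≤ ε / 16 := by
    rw [hδ, div_mul_eq_mul_div, div_le_div_iff₀ (by positivity) (by positivity)]
    nlinarith
  set δ₁ : ℝ := min (1 / 4) δ with hδ₁
  have hδ₁_pos : 0 < δ₁ := lt_min (by norm_num) hδ_pos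
  have hδ₁1 : 4 * δ₁ ≤ 1 := by linarith [min_le_left (1 / 4) δ]
  have hδ₁2 : δ₁ ≤ δ := min_le_right _ _
  obtain ⟨B, χ, hχ⟩ := exists_phases hδ_pos
  have hB : 0 < B := by
    obtain ⟨i, hi, -⟩ := hχ 0 0
    omega
  obtain ⟨C, hC, hbump⟩ := hbump (p + q) (hp.add hq)
  obtain ⟨x', hx', hx'C⟩ := hdec x₀ q hq (ε' / 2) (by positivity)
  obtain ⟨C₁, hC₁, hx'C⟩ := hx'C p hp
  obtain ⟨N, hN, hNC, hNC'⟩ : ∃ N : ℕ, 0 < N ∧ C / (N : ℝ) ^ 2 * 4 ≤ ε / 16 ∧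
      C / (N : ℝ) ^ 2 * 4 < ε' / 2 := by
    have ht : Tendsto (fun N : ℕ => C / (N : ℝ) ^ 2 * 4) atTop (𝓝 0) := by
      have h1 : Tendsto (fun N : ℕ => (N : ℝ) ^ 2) atTop atTop :=
        (tendsto_pow_atTop two_ne_zero).comp tendsto_natCast_atTop_atTop
      simpa using (h1.const_div_atTop C).mul_const 4
    obtain ⟨N, h1, h2, h3⟩ := ((eventually_gt_atTop 0).and
      ((ht.eventually_le_const (show 0 < ε / 16 by positivity)).and
        (ht.eventually_lt_const (show 0 < ε' / 2 by positivity)))).exists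
    exact ⟨N, h1, h2, h3⟩
  have hN' : (0 : ℝ) < N := by exact_mod_cast hN
  have hB' : (0 : ℝ) < B := by exact_mod_cast hB
  set P : ℝ := B * N with hP
  have hP_pos : 0 < P := by positivity
  set κ : ℝ := min η (δ₁ / P) with hκ
  have hκ_pos : 0 < κ := lt_min hη_pos (by positivity)
  have hκη : κ ≤ η := min_le_left _ _
  have hκP : κ * P ≤ δ₁ := by
    rw [← le_div_iff₀ hP_pos]; exact min_le_right _ _
  obtain ⟨m₀, hm₀, hm₀C⟩ : ∃ m₀ : ℕ, 1 ≤ m₀ ∧ ∀ n : ℕ, m₀ ≤ n →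
      C₁ * Real.exp (-(n * η)) ≤ ε / 16 := by
    have ht : Tendsto (fun n : ℕ => C₁ * Real.exp (-(n * η))) atTop (𝓝 0) := by
      have h1 : Tendsto (fun n : ℕ => (n : ℝ) * η) atTop atTop :=
        tendsto_natCast_atTop_atTop.atTop_mul_const hη_pos
      simpa using (Real.tendsto_exp_neg_atTop_nhds_zero.comp h1).const_mul C₁
    obtain ⟨m, hm⟩ := eventually_atTop.1
      (ht.eventually_le_const (show 0 < ε / 16 by positivity))
    exact ⟨max 1 m, le_max_left _ _, fun n hn => hm n (le_of_max_le_right hn)⟩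
  -- The level at time `m₀ P` is the top of the range of `log ‖w‖`.
  set A : ℝ := -σ + η + κ * Real.log (m₀ * P) with hA
  set l : ℕ → ℝ := fun n => A - κ * Real.log n with hl
  obtain ⟨R, hR⟩ : ∃ R : ℕ, ∀ n ≥ R, l n < -σ - 2 * η := by
    have h1 : Tendsto (fun n : ℕ => κ * Real.log n) atTop atTop :=
      (Real.tendsto_log_atTop.comp tendsto_natCast_atTop_atTop).const_mul_atTop hκ_pos
    have h2 : Tendsto l atTop atBot := by
      simpa [hl, sub_eq_add_neg] using
        tendsto_atBot_add_const_left atTop A (tendsto_neg_atTop_atBot.comp h1)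
    exact eventually_atTop.1 (h2.eventually_lt_atBot _)
  -- The extra `η` below `-σ - η` is needed because inside a block the level may lie `κ ≤ η` below
  -- `log ‖w‖`.
  set S : Finset ℕ := (Finset.range R).filter fun j =>
    m₀ * B ≤ j ∧ -σ - 2 * η ≤ l (j * N) with hS
  have hSj : ∀ j ∈ S, 1 ≤ j ∧ m₀ * B ≤ j ∧ j < R ∧ -σ - 2 * η ≤ l (j * N) ∧
      l (j * N) ≤ -σ + η := by
    intro j hj
    obtain ⟨h1, h2, h3⟩ := Finset.mem_filter.1 hj
    have h4 : 1 ≤ j := le_trans (Nat.mul_pos hm₀ hB) h2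
    refine ⟨h4, h2, Finset.mem_range.1 h1, h3, ?_⟩
    have h5 : (m₀ : ℝ) * P ≤ (j * N : ℕ) := by
      rw [hP, ← mul_assoc]; push_cast
      exact mul_le_mul_of_nonneg_right (by exact_mod_cast h2) hN'.le
    have h0 : (0 : ℝ) < m₀ * P := by
      have : (1 : ℝ) ≤ m₀ := by exact_mod_cast hm₀
      positivity
    have h6 := mul_le_mul_of_nonneg_left (Real.log_le_log h0 h5) hκ_pos.le
    simp only [hl, hA]
    linarith
  have hlev : ∀ j ∈ S, |(κ - l (j * N)) - σ| ≤ η₀ := by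
    intro j hj
    obtain ⟨-, -, -, h1, h2⟩ := hSj j hj
    rw [abs_le]; constructor <;> linarith
  have hv : ∀ j : ℕ, ∃ v : X, j ∈ S →
      p (Complex.exp (-((j * N : ℕ) * (κ - l (j * N) : ℝ))) • (T ^ (j * N)) v - y) < ε / 16 ∧
      ∀ k ≤ R * N, k ≠ j * N →
        (p + q) (Complex.exp (-(k * (κ - l (j * N) : ℝ))) • (T ^ k) v) ≤
          C / ((k : ℝ) - (j * N : ℕ)) ^ 2 := by
    intro j
    by_cases hj : j ∈ S
    · obtain ⟨v, hv⟩ := hbump _ (hlev j hj) (j * N) (R * N)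
      exact ⟨v, fun _ => hv⟩
    · exact ⟨0, fun h => absurd h hj⟩
  choose v hv using hv
  set ph : ℕ → ℂ := fun j => Complex.exp ((2 * Real.pi * χ (j % B) : ℝ) * Complex.I) with hph
  have hphn : ∀ j, ‖ph j‖ = 1 := fun j => Complex.norm_exp_ofReal_mul_I _
  -- At its own time `n = jN`, `e^(n l(n)) d_j T^n v_j` equals `ph j` times `e^(-n(κ - l(n))) T^n
  -- v_j`, which is close to `ph j • y`.
  set d : ℕ → ℂ := fun j => ph j * Complex.exp (-(κ * (j * N : ℕ) : ℝ)) with hd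
  -- The bound on `a` is the tangent at `jN` to `n l(n)`, of slope `l(jN) - κ`. The case `k = 0`, `a
  -- = 0` bounds the perturbation of `x₀`; the others bound the interference.
  have hdecay : ∀ j ∈ S, ∀ k : ℕ, k < R → k ≠ j → ∀ a : ℝ,
      a ≤ -((k * N : ℕ) * (κ - l (j * N))) + κ * (j * N : ℕ) →
      (p + q) (Complex.exp a • d j • (T ^ (k * N)) (v j)) ≤
        C / (N : ℝ) ^ 2 * (1 / ((j : ℝ) - k) ^ 2) := by
    intro j hj k hk hkj a ha
    have h1 := (hv j hj).2 (k * N) (Nat.mul_le_mul_right _ hk.le)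
      (fun h => hkj (Nat.eq_of_mul_eq_mul_right hN h))
    have hne : (j : ℝ) - k ≠ 0 := sub_ne_zero.2 (by exact_mod_cast hkj.symm)
    have e : C / (((k * N : ℕ) : ℝ) - (j * N : ℕ)) ^ 2 =
        C / (N : ℝ) ^ 2 * (1 / ((j : ℝ) - k) ^ 2) := by
      push_cast
      rw [← sub_mul, mul_pow, ← neg_sub (j : ℝ) k, neg_sq]
      field_simp
    rw [← e]
    refine le_trans ?_ h1
    simp only [map_smul_eq_mul, hd, norm_mul, hphn, Complex.norm_exp]
    rw [one_mul, ← mul_assoc, ← Real.exp_add]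
    refine mul_le_mul_of_nonneg_right (Real.exp_le_exp.2 ?_) (apply_nonneg _ _)
    have e3 : (-(((k * N : ℕ) : ℂ) * ((κ - l (j * N) : ℝ) : ℂ))).re =
        -((k * N : ℕ) * (κ - l (j * N))) := by
      rw [Complex.neg_re, ← Complex.ofReal_natCast, Complex.re_mul_ofReal, Complex.ofReal_re]
    rw [e3, Complex.ofReal_re, ← Complex.ofReal_neg, Complex.ofReal_re]
    linarith
  refine ⟨x' + ∑ j ∈ S, d j • v j, ?_, ?_⟩
  · have h1 : q (∑ j ∈ S, d j • v j) ≤ C / (N : ℝ) ^ 2 * 4 := by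
      calc q (∑ j ∈ S, d j • v j) ≤ ∑ j ∈ S, q (d j • v j) :=
          Finset.le_sum_of_subadditive q (map_zero q).le (map_add_le_add q) _ _
        _ ≤ ∑ j ∈ S, C / (N : ℝ) ^ 2 * (1 / ((j : ℝ) - (0 : ℕ)) ^ 2) := by
          refine Finset.sum_le_sum fun j hj => ?_
          obtain ⟨hj1, -, hjR, -, -⟩ := hSj j hj
          have := hdecay j hj 0 (by omega) (by omega) 0 (by simp; positivity)
          simp only [zero_mul, pow_zero, Complex.ofReal_zero, Complex.exp_zero, one_smul] at this
          exact (le_add_of_nonneg_left (apply_nonneg p _)).trans this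
        _ ≤ C / (N : ℝ) ^ 2 * 4 := by
          rw [← Finset.mul_sum]
          exact mul_le_mul_of_nonneg_left (sum_inv_sub_sq_le S 0) (by positivity)
    have e : x' + ∑ j ∈ S, d j • v j - x₀ = (x' - x₀) + ∑ j ∈ S, d j • v j := by abel
    rw [e]
    exact (map_add_le_add q _ _).trans_lt (by linarith)
  · intro w hw hwη
    obtain ⟨hw1, hw2⟩ := abs_le.1 hwη
    obtain ⟨m, hm, hmW, hmW'⟩ := exists_logarithmic_block (A := A) (W := Real.log ‖w‖) hκ_pos
      hP_pos (m₀ := m₀) (by rw [hA]; linarith)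
    -- The argument of `w ^ ((m B + i) N)`, measured in turns, is an arithmetic progression in `i`.
    obtain ⟨i, hi, hiχ⟩ := hχ ((m * B * N : ℕ) * Complex.arg w / (2 * Real.pi))
      (N * Complex.arg w / (2 * Real.pi))
    set k := m * B + i with hk
    set n := k * N with hn
    have hn1 : (m : ℝ) * P ≤ n := by
      rw [hn, hk, hP]; push_cast; nlinarith [Nat.cast_nonneg (α := ℝ) i]
    have hn2 : (n : ℝ) ≤ (m + 1 : ℕ) * P := by
      have : (i : ℝ) ≤ B := by exact_mod_cast hi.le
      rw [hn, hk, hP]; push_cast; nlinarith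
    obtain ⟨hb1, hb2⟩ := abs_mul_sub_log_le hκ_pos hP_pos (hm₀.trans hm) hκP hmW hmW' hn1 hn2
    have hln : -σ - 2 * η ≤ l n := by
      have := (abs_le.1 hb2).2
      simp only [hl]
      linarith
    have hkR : k < R := by
      by_contra hcon
      have h1 : R ≤ n := (not_lt.1 hcon).trans (Nat.le_mul_of_pos_right k hN)
      linarith [hR n h1]
    have hkS : k ∈ S := by
      refine Finset.mem_filter.2 ⟨Finset.mem_range.2 hkR, ?_, hln⟩
      exact (Nat.mul_le_mul_right B hm).trans (Nat.le_add_right _ _)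
    have hphk : ph k = Complex.exp ((2 * Real.pi * χ i : ℝ) * Complex.I) := by
      have : k % B = i := by rw [hk, Nat.mul_add_mod', Nat.mod_eq_of_lt hi]
      simp only [hph, this]
    obtain ⟨hω1, hω2⟩ := norm_pow_mul_exp_sub_one_le (θ := 2 * Real.pi * χ i) (δ := δ) hw hδ₁1 hb1 (by
      have e : (n * Complex.arg w + 2 * Real.pi * χ i : ℝ) = 2 * Real.pi *
          ((m * B * N : ℕ) * Complex.arg w / (2 * Real.pi) +
            i * (N * Complex.arg w / (2 * Real.pi)) + χ i) := by
        rw [hn, hk]; push_cast; field_simp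
      rw [e]
      exact hiχ.le)
    rw [← hphk] at hω2
    change ‖w ^ n * Complex.exp (-(n * (l n : ℝ)))‖ ≤ 2 at hω1
    change ‖w ^ n * Complex.exp (-(n * (l n : ℝ))) * ph k - 1‖ ≤ _ at hω2
    set ω := w ^ n * Complex.exp (-(n * (l n : ℝ))) with hω
    set u := x' + ∑ j ∈ S, d j • v j with hu
    refine ⟨n, ?_⟩
    have hsplit : Complex.exp (n * l n : ℝ) • (T ^ n) u - ph k • y =
        Complex.exp (n * l n : ℝ) • (T ^ n) x' +
          ∑ j ∈ S.erase k, Complex.exp (n * l n : ℝ) • d j • (T ^ n) (v j) +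
          ph k • (Complex.exp (-((k * N : ℕ) * (κ - l (k * N) : ℝ))) • (T ^ (k * N)) (v k) - y) := by
      have h1 : Complex.exp (n * l n : ℝ) • d k • (T ^ n) (v k) =
          ph k • Complex.exp (-((k * N : ℕ) * (κ - l (k * N) : ℝ))) • (T ^ (k * N)) (v k) := by
        rw [← hn, smul_smul, smul_smul]
        congr 1
        simp only [hd]
        rw [← hn, mul_left_comm, ← Complex.exp_add]
        congr 2
        push_cast
        ring
      rw [hu, map_add, map_sum, smul_add, Finset.smul_sum, ← Finset.add_sum_erase S _ hkS,
        smul_sub, ← h1]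
      simp only [map_smul]
      abel
    have hz1 : p (Complex.exp (n * l n : ℝ) • (T ^ n) x') ≤ ε / 16 := by
      rw [map_smul_eq_mul, Complex.norm_exp, Complex.ofReal_re]
      have hmn : m₀ ≤ n := by
        have h1 : 1 ≤ B * N := Nat.mul_pos hB hN
        calc m₀ ≤ m := hm
          _ ≤ m * (B * N) := Nat.le_mul_of_pos_right m h1
          _ ≤ n := by rw [hn, hk, ← mul_assoc]; exact Nat.mul_le_mul_right N (by omega)
      have hle := (hSj k hkS).2.2.2.2
      refine le_trans ?_ (hm₀C n hmn)
      calc Real.exp (n * l n) * p ((T ^ n) x')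
          ≤ Real.exp (n * l n) * (C₁ * Real.exp (n * τ)) := by gcongr; exact hx'C n
        _ = C₁ * Real.exp (n * l n + n * τ) := by rw [Real.exp_add]; ring
        _ ≤ C₁ * Real.exp (-(n * η)) := by
          gcongr
          rw [← hn] at hle
          have : (n : ℝ) * (l n + τ + η) ≤ 0 :=
            mul_nonpos_of_nonneg_of_nonpos (Nat.cast_nonneg n) (by linarith)
          linarith
    have hz2 : p (∑ j ∈ S.erase k, Complex.exp (n * l n : ℝ) • d j • (T ^ n) (v j)) ≤ ε / 16 := by
      calc p (∑ j ∈ S.erase k, Complex.exp (n * l n : ℝ) • d j • (T ^ n) (v j))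
          ≤ ∑ j ∈ S.erase k, p (Complex.exp (n * l n : ℝ) • d j • (T ^ n) (v j)) :=
            Finset.le_sum_of_subadditive p (map_zero p).le (map_add_le_add p) _ _
        _ ≤ ∑ j ∈ S.erase k, C / (N : ℝ) ^ 2 * (1 / ((j : ℝ) - k) ^ 2) := by
          refine Finset.sum_le_sum fun j hj => ?_
          obtain ⟨hjk, hj⟩ := Finset.mem_erase.1 hj
          refine (le_add_of_nonneg_right (apply_nonneg q _)).trans
            (hdecay j hj k hkR hjk.symm _ ?_)
          have hj0 : (0 : ℝ) < (j * N : ℕ) := by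
            exact_mod_cast Nat.mul_pos (hSj j hj).1 hN
          have hk0 : (0 : ℝ) < (k * N : ℕ) := by
            exact_mod_cast Nat.mul_pos (hSj k hkS).1 hN
          have := mul_le_mul_of_nonneg_left (mul_log_sub_log_add_sub_nonpos hk0 hj0) hκ_pos.le
          simp only [hl, hn]
          linarith
        _ ≤ C / (N : ℝ) ^ 2 * 4 := by
          rw [← Finset.mul_sum]
          exact mul_le_mul_of_nonneg_left (sum_inv_sub_sq_le _ k) (by positivity)
        _ ≤ ε / 16 := hNC
    have hz3 : p (ph k • (Complex.exp (-((k * N : ℕ) * (κ - l (k * N) : ℝ))) •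
        (T ^ (k * N)) (v k) - y)) ≤ ε / 16 := by
      rw [map_smul_eq_mul, hphn, one_mul]
      exact (hv k hkS).1.le
    have hz : p (Complex.exp (n * l n : ℝ) • (T ^ n) u - ph k • y) ≤ 3 * (ε / 16) := by
      rw [hsplit]
      refine (map_add_le_add p _ _).trans ?_
      have := map_add_le_add p (Complex.exp (n * l n : ℝ) • (T ^ n) x')
        (∑ j ∈ S.erase k, Complex.exp (n * l n : ℝ) • d j • (T ^ n) (v j))
      linarith
    have hfin : w ^ n • (T ^ n) u - y =
        ω • (Complex.exp (n * l n : ℝ) • (T ^ n) u - ph k • y) + (ω * ph k - 1) • y := by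
      have : ω * Complex.exp (n * l n : ℝ) = w ^ n := by
        rw [hω, mul_assoc, ← Complex.exp_add]
        push_cast
        rw [neg_add_cancel, Complex.exp_zero, mul_one]
      rw [smul_sub, smul_smul, smul_smul, this, sub_smul, one_smul]
      abel
    rw [hfin]
    refine (map_add_le_add p _ _).trans_lt ?_
    rw [map_smul_eq_mul, map_smul_eq_mul]
    have hA1 : ‖ω‖ * p (Complex.exp (n * l n : ℝ) • (T ^ n) u - ph k • y) ≤ 2 * (3 * (ε / 16)) :=
      mul_le_mul hω1 hz (apply_nonneg _ _) two_pos.le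
    have hA2 : ‖ω * ph k - 1‖ * p y ≤ (2 * δ + 4 * δ₁) * p y :=
      mul_le_mul_of_nonneg_right hω2 hY
    have hA3 : (2 * δ + 4 * δ₁) * p y ≤ 6 * (ε / 16) := by
      have := mul_le_mul_of_nonneg_right hδ₁2 hY
      linarith
    linarith

end Simultaneous

/-! ### Open dense sets attached to annuli. -/

section Main

variable {X : Type*} [AddCommGroup X] [Module ℂ X] [UniformSpace X] [IsUniformAddGroup X]
  [ContinuousSMul ℂ X] {m : ℕ} {T : X →L[ℂ] X} {U : Set (Fin m → ℂ)} {f : (Fin m → ℂ) → X}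
  {φ : (Fin m → ℂ) → ℂ}

theorem exists_forall_seminorm_pow_le (hT : ∀ z ∈ U, T (f z) = φ z • f z) {τ : ℝ} {x : X}
    (hx : x ∈ Submodule.span ℂ (f '' {z ∈ U | ‖φ z‖ < Real.exp τ})) (p : Seminorm ℂ X) :
    ∃ C ≥ 0, ∀ n : ℕ, p ((T ^ n) x) ≤ C * Real.exp (n * τ) := by
  induction hx using Submodule.span_induction with
  | mem x h =>
    obtain ⟨z, ⟨hz, hzτ⟩, rfl⟩ := h
    refine ⟨p (f z), apply_nonneg _ _, fun n => ?_⟩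
    have e : (T ^ n) (f z) = φ z ^ n • f z := by
      induction n with
      | zero => simp
      | succ n ih => rw [pow_succ', mul_apply_eq_comp, ih, map_smul, hT z hz, smul_smul, ← pow_succ]
    rw [e, map_smul_eq_mul, norm_pow, mul_comm, Real.exp_nat_mul]
    gcongr
  | zero => exact ⟨0, le_rfl, by simp⟩
  | add x y _ _ hx hy =>
    obtain ⟨C, hC, h⟩ := hx
    obtain ⟨D, hD, h'⟩ := hy
    refine ⟨C + D, by positivity, fun n => ?_⟩
    rw [map_add, add_mul]
    exact (map_add_le_add p _ _).trans (add_le_add (h n) (h' n))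
  | smul c x _ hx =>
    obtain ⟨C, hC, h⟩ := hx
    refine ⟨‖c‖ * C, by positivity, fun n => ?_⟩
    rw [map_smul, map_smul_eq_mul, mul_assoc]
    exact mul_le_mul_of_nonneg_left (h n) (norm_nonneg c)

/-- Joint continuity of `(x, w) ↦ (wT)^n x` and compactness of `K`. -/
theorem isOpen_forall_exists_pow_mem {K : Set ℂ} (hK : IsCompact K) {O : Set X} (hO : IsOpen O) :
    IsOpen {x : X | ∀ w ∈ K, ∃ n : ℕ, ((w • T) ^ n) x ∈ O} := by
  rw [isOpen_iff_eventually]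
  intro x hx
  refine hK.eventually_forall_of_forall_eventually fun w hw => ?_
  obtain ⟨n, hn⟩ := hx w hw
  have hc : Continuous fun q : X × ℂ => ((q.2 • T) ^ n) q.1 := by
    simp only [smul_pow, smul_apply]
    fun_prop
  filter_upwards [(hO.preimage hc).mem_nhds (show (x, w) ∈ _ from hn)] with q hq
  exact ⟨n, hq⟩

variable [Module ℝ X] [IsScalarTower ℝ ℂ X] [LocallyConvexSpace ℝ X]

open scoped ComplexOrder in
theorem PolynormableSpace.of_locallyConvexSpace_real : PolynormableSpace ℂ X := by
  have : ContinuousSMul ℝ X := IsScalarTower.continuousSMul ℂ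
  have : LocallyConvexSpace ℂ X := by
    refine (locallyConvexSpace_iff_exists_convex_subset ℂ X).2 fun x V hV => ?_
    obtain ⟨S, hS, hSc, hSV⟩ := (locallyConvexSpace_iff_exists_convex_subset ℝ X).1 ‹_› x V hV
    -- Nonnegative scalars in the order of `ℂ` are real, so both notions of convexity agree.
    refine ⟨S, hS, convex_of_nonneg_surjective_algebraMap (R := ℝ) _ (fun c hc => ?_) hSc, hSV⟩
    obtain ⟨r, hr, rfl⟩ := RCLike.nonneg_iff_exists_ofReal.1 (mem_Ici.1 hc)
    exact ⟨r, hr, rfl⟩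
  infer_instance

theorem exists_dense_forall_exists_pow_mem (hUo : IsOpen U) (hUc : IsPreconnected U)
    (hf : IsHolomorphicOn f U) (hφ : DifferentiableOn ℂ φ U)
    (hT : ∀ z ∈ U, T (f z) = φ z • f z) (hspan : Dense (Submodule.span ℂ (f '' U) : Set X))
    {r : ℝ} (hr : 0 < r) (hlow : ∃ z ∈ U, ‖φ z‖ < r⁻¹) (hhigh : ∃ z ∈ U, r⁻¹ < ‖φ z‖)
    {O : Set X} (hO : IsOpen O) (hOn : O.Nonempty) :
    ∃ s₁ s₂ : ℝ, 0 < s₁ ∧ s₁ < r ∧ r < s₂ ∧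
      Dense {x : X | ∀ w : ℂ, ‖w‖ ∈ Icc s₁ s₂ → ∃ n : ℕ, ((w • T) ^ n) x ∈ O} := by
  have : PolynormableSpace ℂ X := PolynormableSpace.of_locallyConvexSpace_real
  set σ : ℝ := -Real.log r with hσ
  have hexp : Real.exp σ = r⁻¹ := by rw [hσ, Real.exp_neg, Real.exp_log hr]
  rw [← hexp] at hlow hhigh
  obtain ⟨τ, hτ, hlowτ⟩ : ∃ τ < σ, ∃ z ∈ U, ‖φ z‖ < Real.exp τ := by
    obtain ⟨z, hz, hzσ⟩ := hlow
    obtain ⟨t, ht, htσ⟩ := exists_between hzσ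
    have ht0 : 0 < t := (norm_nonneg _).trans_lt ht
    refine ⟨Real.log t, ?_, z, hz, by rwa [Real.exp_log ht0]⟩
    rwa [Real.log_lt_iff_lt_exp ht0]
  obtain ⟨y, hy⟩ := hOn
  obtain ⟨p, hp, ε, hε, hpO⟩ := Seminorm.exists_forall_lt_imp_mem (hO.mem_nhds hy)
  have hbump := isBumpApproximable_of_dense_span
    (dense_span_eigenfield hUo hUc hf hφ hT hspan hlow hhigh) y
  have hdec : ∀ (x : X) (q : Seminorm ℂ X), Continuous q → ∀ ε > 0, ∃ x', q (x' - x) < ε ∧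
      ∀ p : Seminorm ℂ X, Continuous p →
        ∃ C ≥ 0, ∀ n : ℕ, p ((T ^ n) x') ≤ C * Real.exp (n * τ) := by
    intro x q hq ε hε
    have ho : IsOpen {x' | q (x' - x) < ε} := isOpen_lt (by fun_prop) continuous_const
    obtain ⟨x', hx'S, hx'⟩ := (dense_span_image_norm_lt hUo hUc hf hφ hspan hlowτ).exists_mem_open
      ho ⟨x, by simpa using hε⟩
    exact ⟨x', hx', fun p _ => exists_forall_seminorm_pow_le hT hx'S p⟩
  obtain ⟨η, hη, h⟩ := exists_simultaneous_approx hτ hbump hdec hp hε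
  refine ⟨r * Real.exp (-η), r * Real.exp η, by positivity, ?_, ?_, ?_⟩
  · exact mul_lt_of_lt_one_right hr (by simpa using hη)
  · exact lt_mul_of_one_lt_right hr (by simpa using hη)
  · rw [dense_iff_inter_open]
    rintro V hV ⟨x₀, hx₀⟩
    obtain ⟨q, hq, ε', hε', hqV⟩ := Seminorm.exists_forall_lt_imp_mem (hV.mem_nhds hx₀)
    obtain ⟨u, hu, huw⟩ := h x₀ q hq ε' hε'
    refine ⟨u, hqV u hu, fun w ⟨hw1, hw2⟩ => ?_⟩
    have hw0 : 0 < ‖w‖ := lt_of_lt_of_le (by positivity) hw1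
    obtain ⟨n, hn⟩ := huw w (norm_pos_iff.1 hw0) (by
      have h1 := Real.log_le_log (by positivity) hw1
      have h2 := Real.log_le_log hw0 hw2
      rw [Real.log_mul hr.ne' (Real.exp_pos _).ne', Real.log_exp] at h1 h2
      rw [hσ, abs_le]
      constructor <;> linarith)
    refine ⟨n, hpO _ ?_⟩
    rwa [smul_pow, smul_apply]

end Main

/-! ### The Baire category argument. -/

theorem theorem4 (m : ℕ) (hm : 1 ≤ m)
    {X : Type*} [AddCommGroup X] [Module ℂ X] [UniformSpace X] [IsUniformAddGroup X]
    [ContinuousSMul ℂ X] [Module ℝ X] [IsScalarTower ℝ ℂ X] [LocallyConvexSpace ℝ X] [CompleteSpace X]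
    [TopologicalSpace.MetrizableSpace X]
    (T : X →L[ℂ] X)
    (U : Set (Fin m → ℂ)) (hUo : IsOpen U) (hUc : IsConnected U)
    (f : (Fin m → ℂ) → X) (hf : IsHolomorphicOn f U)
    (φ : (Fin m → ℂ) → ℂ) (hφ : DifferentiableOn ℂ φ U)
    (hφc : ¬ ∃ c : ℂ, ∀ z ∈ U, φ z = c)
    (hT : ∀ z ∈ U, T (f z) = φ z • f z)
    (hspan : Dense (Submodule.span ℂ (f '' U) : Set X))
    (a b : ℝ≥0∞) (ha : a = ⨅ z ∈ U, ‖φ z‖ₑ) (hb : b = ⨆ z ∈ U, ‖φ z‖ₑ) :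
    Dense (commonHypercyclicVectors
        fun w : {w : ℂ // b⁻¹ < ‖w‖ₑ ∧ ‖w‖ₑ < a⁻¹} => (w : ℂ) • T) ∧
      IsGδ (commonHypercyclicVectors
        fun w : {w : ℂ // b⁻¹ < ‖w‖ₑ ∧ ‖w‖ₑ < a⁻¹} => (w : ℂ) • T) := by
  have hsep : TopologicalSpace.SeparableSpace X := by
    have h1 : TopologicalSpace.IsSeparable (f '' U) :=
      hf.1.isSeparable_image (TopologicalSpace.IsSeparable.of_separableSpace U)
    rw [← TopologicalSpace.isSeparable_univ_iff, ← hspan.closure_eq]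
    exact (h1.span (R := ℂ)).closure
  have hcg : (uniformity X).IsCountablyGenerated :=
    IsUniformAddGroup.uniformity_countably_generated
  have hsc : SecondCountableTopology X := UniformSpace.secondCountable_of_separable X
  have hbaire : BaireSpace X := inferInstance
  set G : Set X → ℚ × ℚ → Set X := fun O s =>
    {x : X | ∀ w : ℂ, ‖w‖ ∈ Icc (s.1 : ℝ) s.2 → ∃ n : ℕ, ((w • T) ^ n) x ∈ O} with hG
  -- Only sets already known to be dense are kept; `key` shows that these still cut out exactly the
  -- common hypercyclic vectors.
  set 𝒮 : Set (Set X) := {V | ∃ O ∈ TopologicalSpace.countableBasis X, ∃ s : ℚ × ℚ,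
    (∀ w : ℂ, ‖w‖ ∈ Icc (s.1 : ℝ) s.2 → b⁻¹ < ‖w‖ₑ ∧ ‖w‖ₑ < a⁻¹) ∧ Dense (G O s) ∧
      V = G O s} with h𝒮
  have h𝒮c : 𝒮.Countable := by
    refine (((TopologicalSpace.countable_countableBasis X).prod
      (countable_univ (α := ℚ × ℚ))).image fun q => G q.1 q.2).mono ?_
    rintro V ⟨O, hO, s, -, -, rfl⟩
    exact ⟨(O, s), ⟨hO, mem_univ _⟩, rfl⟩
  have h𝒮o : ∀ V ∈ 𝒮, IsOpen V := by
    rintro V ⟨O, hO, s, -, -, rfl⟩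
    have hK : IsCompact {w : ℂ | ‖w‖ ∈ Icc (s.1 : ℝ) s.2} := by
      refine (isCompact_closedBall (0 : ℂ) s.2).of_isClosed_subset
        (isClosed_Icc.preimage continuous_norm) fun w hw => ?_
      simpa using hw.2
    exact isOpen_forall_exists_pow_mem hK (TopologicalSpace.isOpen_of_mem_countableBasis hO)
  have hbasis := TopologicalSpace.isBasis_countableBasis X
  have key : (commonHypercyclicVectors
      fun w : {w : ℂ // b⁻¹ < ‖w‖ₑ ∧ ‖w‖ₑ < a⁻¹} => (w : ℂ) • T) = ⋂₀ 𝒮 := by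
    ext x
    simp only [commonHypercyclicVectors, hypercyclicVectors, universalElements, mem_iInter]
    constructor
    · rintro hx V ⟨O, hO, s, hs, -, rfl⟩ w hw
      obtain ⟨_, ⟨n, rfl⟩, hn⟩ := Dense.exists_mem_open (hx ⟨w, hs w hw⟩)
        (TopologicalSpace.isOpen_of_mem_countableBasis hO)
        (TopologicalSpace.nonempty_of_mem_countableBasis hO)
      exact ⟨n, hn⟩
    · rintro hx ⟨w, hw⟩
      refine hbasis.dense_iff.2 fun O hO hOn => ?_
      have hOo := TopologicalSpace.isOpen_of_mem_countableBasis hO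
      have hw0 : w ≠ 0 := by
        rintro rfl
        simp at hw
      have hwpos : 0 < ‖w‖ := norm_pos_iff.2 hw0
      have hlt : ∀ z₁ z₂ : ℂ, ‖z₁‖ₑ < ‖z₂‖ₑ → ‖z₁‖ < ‖z₂‖ := fun z₁ z₂ h => by
        rwa [← ofReal_norm, ← ofReal_norm,
          ENNReal.ofReal_lt_ofReal_iff_of_nonneg (norm_nonneg _)] at h
      have hhigh : ∃ z ∈ U, ‖w‖⁻¹ < ‖φ z‖ := by
        have h1 := ENNReal.inv_lt_iff_inv_lt.1 hw.1
        rw [hb, ← enorm_inv hw0] at h1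
        obtain ⟨z, h1⟩ := lt_iSup_iff.1 h1
        obtain ⟨hz, h1⟩ := lt_iSup_iff.1 h1
        exact ⟨z, hz, by simpa using hlt _ _ h1⟩
      have hlow : ∃ z ∈ U, ‖φ z‖ < ‖w‖⁻¹ := by
        have h1 := ENNReal.lt_inv_iff_lt_inv.1 hw.2
        rw [ha, ← enorm_inv hw0] at h1
        obtain ⟨z, h1⟩ := iInf_lt_iff.1 h1
        obtain ⟨hz, h1⟩ := iInf_lt_iff.1 h1
        exact ⟨z, hz, by simpa using hlt _ _ h1⟩
      obtain ⟨s₁, s₂, hs₁, hs₁w, hs₂w, hd⟩ := exists_dense_forall_exists_pow_mem hUo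
        hUc.isPreconnected hf hφ hT hspan hwpos hlow hhigh hOo hOn
      have hnear : {s : ℝ | b⁻¹ < ENNReal.ofReal s ∧ ENNReal.ofReal s < a⁻¹} ∩ Ioo s₁ s₂ ∈
          𝓝 ‖w‖ := by
        refine inter_mem (IsOpen.mem_nhds ?_ ?_) (Ioo_mem_nhds hs₁w hs₂w)
        · exact (isOpen_lt continuous_const ENNReal.continuous_ofReal).inter
            (isOpen_lt ENNReal.continuous_ofReal continuous_const)
        · simpa only [mem_ofPred_eq, ofReal_norm] using hw
      -- The interval of radii shrinks to one with rational endpoints, which keeps the family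
      -- countable and only enlarges the dense set.
      obtain ⟨t₁, t₂, ht, hsub⟩ := mem_nhds_iff_exists_Ioo_subset.1 hnear
      obtain ⟨q₁, hq₁, hq₁'⟩ := exists_rat_btwn ht.1
      obtain ⟨q₂, hq₂, hq₂'⟩ := exists_rat_btwn ht.2
      have hIcc : ∀ s ∈ Icc (q₁ : ℝ) q₂, s ∈ Ioo t₁ t₂ := fun s hs =>
        ⟨hq₁.trans_le hs.1, hs.2.trans_lt hq₂'⟩
      have hmem : G O (q₁, q₂) ∈ 𝒮 := by
        refine ⟨O, hO, (q₁, q₂), fun v hv => ?_, hd.mono fun x hx v hv => ?_, rfl⟩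
        · have := (hsub (hIcc _ hv)).1
          simpa only [mem_ofPred_eq, ofReal_norm] using this
        · exact hx v (Ioo_subset_Icc_self (hsub (hIcc _ hv)).2)
      obtain ⟨n, hn⟩ := hx _ hmem w ⟨hq₁'.le, hq₂.le⟩
      exact ⟨_, hn, n, rfl⟩
  rw [key]
  refine ⟨dense_sInter_of_isOpen h𝒮o h𝒮c ?_, 𝒮, h𝒮o, h𝒮c, rfl⟩
  rintro V ⟨O, hO, s, -, hd, rfl⟩
  exact hd
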